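/- **Setting.** Let $\mathcal S\subset\mathbb C\setminus\{0\}$ be a finite constellation, and let $s$ be uniformly distributed on $\mathcal S$. Assume $\mathbb E|s|^2=1$, $\mathbb E s=0$, $\mathbb E s^2=0$, that every magnitude ring of $\mathcal S$ is centrally symmetric ($s\in\mathcal S\Rightarrow -s\in\mathcal S$), and that the constellation is sub-Gaussian, i.e. its kurtosis satisfies $\kappa=\mathbb E|s|^4<2$. Let $L$ targets have distinct delays $\tau_1,\dots,\tau_L\in\mathbb R$ and non-zero complex amplitudes $\beta_1,\dots,\beta_L$, and let $\sigma>0$. For $N\ge 1$ let $\mathbf s\in\mathcal S^N$ have independent entries uniformly distributed on $\mathcal S$, let $\mathbf F_N$ be the unitary DFT matrix, $[\mathbf F_N]_{m,n}=N^{-1/2}e^{-j2\pi mn/N}$ ($0\le m,n<N$), and $\mathbf P_\tau=\mathbf F_N^H\operatorname{Diag}\{e^{-j2\pi n\tau/N}\}_{n=0}^{N-1}\mathbf F_N$. For a unitary $\mathbf U$ put $\boldsymbol\mu_{\boldsymbol\theta}=\sum_{\ell}\beta_\ell\mathbf P_{\tau_\ell}\mathbf U\mathbf s$ with the real parameters $\boldsymbol\theta=(\tau_\ell,\operatorname{Re}\beta_\ell,\operatorname{Im}\beta_\ell)_{\ell}\in\mathbb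 R^{3L}$, let $J_{k,l}=\frac{2}{\sigma^2}\operatorname{Re}\{(\partial_{\theta_k}\boldsymbol\mu)^H(\partial_{\theta_l}\boldsymbol\mu)\}$ be the Fisher information matrix, and let $f(\mathbf U)=f(\mathbf U,\mathbf s)=\operatorname{Tr}\{\mathbf T\mathbf J^{-1}\}$, where $\mathbf T=\operatorname{Diag}(\mathbf I_L,\mathbf 0_{2L})$ selects the delays; $\mathbb E[f(\mathbf U)]$ is the ranging CRB, and $\mathbf U=\mathbf F_N^H$ is OFDM. **Theorem 3 (Semidefiniteness of the Large-$N$ Hessian at OFDM).** Let $\mathbf K=(\mathbf K_N)_{N\ge1}$ be any family of skew-Hermitian matrices $\mathbf K_N\in\mathbb C^{N\times N}$ with spectral norm $\|\mathbf K_N\|_2=1$, and consider the geodesics $\mathbf U(t)=\mathbf F_N^He^{t\mathbf K_N}$ of the unitary group. Then there exists $N_0(\mathbf K)$ such that for all $N\ge N_0(\mathbf K)$, for $t$ near $0$ the matrix $\mathbf J$ at $\mathbf U(t)$ is invertible for every realization of $\mathbf s$, the function $t\mapsto\mathbb E\{f[\mathbf U(t)]\}$ is twice continuously differentiable at $0$,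 and $$\left.\frac{d^2}{dt^2}\mathbb E\{f[\mathbf U(t)]\}\right|_{t=0}\ge 0 .$$ Consequently, for all sufficiently large $N$ the Riemannian Hessian of $\mathbf U\mapsto\mathbb E[f(\mathbf U)]$ on the unitary group $\mathbb U(N)$ at $\mathbf U=\mathbf F_N^H$ is positive semidefinite: for every skew-Hermitian $\mathbf K\in\mathbb C^{N\times N}$ the second derivative at $t=0$ along $t\mapsto\mathbf F_N^He^{t\mathbf K}$ is well defined in the above sense and nonnegative. -/

import Mathlib

open scoped Matrix Topology

noncomputable section

namespace OFDM

/-! ### Constellations -/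

/-- Expectation of `g s` for a symbol `s` drawn uniformly from the finite alphabet `S`. -/
def symbolMean (S : Finset ℂ) (g : ℂ → ℂ) : ℂ := (∑ s ∈ S, g s) / (S.card : ℂ)

/-- The same expectation, for real-valued `g`. -/
def symbolMeanReal (S : Finset ℂ) (g : ℂ → ℝ) : ℝ := (∑ s ∈ S, g s) / (S.card : ℝ)

/-- The kurtosis `κ = E|s - E s|⁴ / (E|s - E s|²)²` of the uniform constellation on `S`. -/
def kurtosis (S : Finset ℂ) : ℝ :=
  symbolMeanReal S (fun s => ‖s - symbolMean S (fun z => z)‖ ^ 4) /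
    symbolMeanReal S (fun s => ‖s - symbolMean S (fun z => z)‖ ^ 2) ^ 2

/-- A uniform sub-Gaussian constellation without zero element: unit power, zero mean, zero
pseudo-variance, each magnitude ring centrally symmetric, and kurtosis smaller than two. -/
structure IsSubGaussianConstellation (S : Finset ℂ) : Prop where
  zero_notMem : (0 : ℂ) ∉ S
  unit_power : symbolMeanReal S (fun s => ‖s‖ ^ 2) = 1
  mean_zero : symbolMean S (fun s => s) = 0
  pseudo_variance_zero : symbolMean S (fun s => s ^ 2) = 0
  central_symmetry : ∀ ρ : ℝ, ∀ s ∈ S, ‖s‖ ^ 2 = ρ → -s ∈ S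
  kurtosis_lt_two : kurtosis S < 2

/-- The set of all blocks of `N` symbols from the alphabet `S`. -/
def blocks (S : Finset ℂ) (N : ℕ) : Finset (Fin N → ℂ) := Fintype.piFinset (fun _ => S)

/-- Expectation of `g s` when the `N` entries of `s` are independent and uniform on `S`. -/
def blockMean (S : Finset ℂ) (N : ℕ) (g : (Fin N → ℂ) → ℝ) : ℝ :=
  (∑ s ∈ blocks S N, g s) / ((blocks S N).card : ℝ)

/-! ### DFT matrix and periodic delays -/

/-- The normalized `N`-point DFT matrix (indices start at `0`). -/
def dft (N : ℕ) : Matrix (Fin N) (Fin N) ℂ :=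
  Matrix.of fun m n =>
    ((1 / Real.sqrt N : ℝ) : ℂ) *
      Complex.exp (-(2 * Real.pi * Complex.I * (m : ℕ) * (n : ℕ) / N))

/-- The periodic (fractional) delay operator `P_τ = F_Nᴴ Diag(e^{-j2πnτ/N}) F_N`. -/
def delay (N : ℕ) (τ : ℝ) : Matrix (Fin N) (Fin N) ℂ :=
  (dft N)ᴴ *
    Matrix.diagonal (fun n : Fin N =>
      Complex.exp (-(2 * Real.pi * Complex.I * (n : ℕ) * τ / N))) * dft N

/-! ### Fisher information and the ranging CRB -/

/-- Indices of the `3L` real parameters: the delays, then the real parts, then the imaginary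
parts of the amplitudes. -/
abbrev Param (L : ℕ) : Type := Fin L ⊕ (Fin L ⊕ Fin L)

/-- The parameter vector `θ = [τ, Re β, Im β]`. -/
def paramVec {L : ℕ} (τ : Fin L → ℝ) (β : Fin L → ℂ) : Param L → ℝ :=
  Sum.elim τ (Sum.elim (fun l => (β l).re) (fun l => (β l).im))

/-- The noise-free echo `μ_θ = ∑ β_l P_{τ_l} x`, as a function of `θ`. -/
def meanSignal {L : ℕ} (N : ℕ) (x : Fin N → ℂ) (θ : Param L → ℝ) : Fin N → ℂ :=
  ∑ l : Fin L,
    ((θ (Sum.inr (Sum.inl l)) : ℂ) + Complex.I * (θ (Sum.inr (Sum.inr l)) : ℂ)) •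
      (delay N (θ (Sum.inl l)) *ᵥ x)

/-- The Fisher information matrix of `y ∼ CN(μ_θ, σ² I)` at `θ`:
`J_{kl} = (2/σ²) Re((∂μ/∂θ_k)ᴴ (∂μ/∂θ_l))`. -/
def fim {L : ℕ} (N : ℕ) (σ : ℝ) (x : Fin N → ℂ) (θ : Param L → ℝ) :
    Matrix (Param L) (Param L) ℝ :=
  Matrix.of fun k l =>
    2 / σ ^ 2 *
      (star (lineDeriv ℝ (meanSignal N x) θ (Pi.single k 1)) ⬝ᵥ
        lineDeriv ℝ (meanSignal N x) θ (Pi.single l 1)).re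

/-- The matrix `T_τ = [I_L, 0]` that selects the delays. -/
def selectDelays (L : ℕ) : Matrix (Fin L) (Param L) ℝ := Matrix.fromCols 1 0

/-- The ranging CRB `f(U, s) = Tr(T J⁻¹)`, `T = T_τᵀ T_τ`, given the symbol block `s`. -/
def conditionalCRB {L : ℕ} (N : ℕ) (σ : ℝ) (τ : Fin L → ℝ) (β : Fin L → ℂ)
    (U : Matrix (Fin N) (Fin N) ℂ) (s : Fin N → ℂ) : ℝ :=
  ((selectDelays L)ᵀ * selectDelays L * (fim N σ (U *ᵥ s) (paramVec τ β))⁻¹).trace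

/-- The ranging CRB `E[f(U, s)]` of the waveform `U`. -/
def expectedCRB {L : ℕ} (S : Finset ℂ) (N : ℕ) (σ : ℝ) (τ : Fin L → ℝ) (β : Fin L → ℂ)
    (U : Matrix (Fin N) (Fin N) ℂ) : ℝ :=
  blockMean S N (conditionalCRB N σ τ β U)

/-! ### The geodesics through OFDM -/

/-- Spectral norm of a square complex matrix. -/
def specNorm {N : ℕ} (K : Matrix (Fin N) (Fin N) ℂ) : ℝ :=
  ‖Matrix.toEuclideanCLM (n := Fin N) (𝕜 := ℂ) K‖

/-- The geodesic `U(t) = F_Nᴴ e^{tK}` of the unitary group (for skew-Hermitian `K`). -/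
def geodesic {N : ℕ} (K : Matrix (Fin N) (Fin N) ℂ) (t : ℝ) : Matrix (Fin N) (Fin N) ℂ :=
  (dft N)ᴴ * NormedSpace.exp (t • K)

/-- `t ↦ E[f(U(t), s)]` along the geodesic. -/
def crbAlong {L : ℕ} (S : Finset ℂ) (N : ℕ) (σ : ℝ) (τ : Fin L → ℝ) (β : Fin L → ℂ)
    (K : Matrix (Fin N) (Fin N) ℂ) (t : ℝ) : ℝ :=
  expectedCRB S N σ τ β (geodesic K t)

/-- The quadratic form of the Riemannian Hessian of `U ↦ E[f(U, s)]` on the unitary group at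
`F_Nᴴ`, in the tangent direction `F_Nᴴ K`: the second derivative at `0` along the geodesic with
that initial velocity. -/
def hessianForm {L : ℕ} (S : Finset ℂ) (N : ℕ) (σ : ℝ) (τ : Fin L → ℝ) (β : Fin L → ℂ)
    (K : Matrix (Fin N) (Fin N) ℂ) : ℝ :=
  iteratedDeriv 2 (crbAlong S N σ τ β K) 0

/-- The expected CRB is meaningful near `t = 0` along the geodesic (for `t` close to `0` the Fisher
information is invertible for every symbol block) and it is twice continuously differentiable
at `0`. -/
def WellDefinedNearZero {L : ℕ} (S : Finset ℂ) (N : ℕ) (σ : ℝ) (τ : Fin L → ℝ)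
    (β : Fin L → ℂ) (K : Matrix (Fin N) (Fin N) ℂ) : Prop :=
  (∀ᶠ t in 𝓝 (0 : ℝ), ∀ s ∈ blocks S N,
    IsUnit (fim N σ (geodesic K t *ᵥ s) (paramVec τ β)).det) ∧
  ContDiffAt ℝ 2 (crbAlong S N σ τ β K) 0

end OFDM

end

noncomputable section

namespace OFDM

open Finset

variable {L : ℕ}

/-! ### The steering vector and its Gram matrix -/

/-! In the frequency domain every delay is diagonal, so the Fisher matrix of `F_Nᴴ V s` is `2/σ²`
times `∑ p_n A_n`, where `A_n` is the information matrix of the frequency `n/N` and `p_n = |(V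
s)_n|²` (`fim_eq`). Along the geodesic only the powers `p_n` move. With `B` the inverse of `∑ |s_n|²
A_n`, the second derivative of the delay trace of the inverse at `t = 0` is that of `2 B J' B J' B -
B J'' B`, where `J'` and `J''` carry the first and second derivatives of the powers.

The matrix `B` depends on the moduli `|s_n|` only, while the constellation is symmetric. Averaging
over the sign of each symbol therefore removes all mixed terms, and the Hessian splits into a sum
over pairs of tones (`sum_blocks_first_order`, `sum_blocks_second_order`). With `Δ = A_n - A_m` and
`x = 2 Re(s̄_n K_nm s_m)`, a pair contributes the average of `x² tr(BΔBΔB) + |K_nm|² (|s_n|² -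
|s_m|²) tr(BΔB)`, traces being over the delays.

Exchanging `s_n` and `s_m` turns the second term, by the resolvent identity, into minus `|K_nm|²
(|s_n|² - |s_m|²)²` times a trace of the kind `tr(BΔBΔB)`. If both powers inside `B` could be
replaced by `1`, that trace `G` would be independent of `s_n` and `s_m`, and the moments `E x² =
2|K_nm|²` and `E(|s_n|² - |s_m|²)² = 2(κ - 1)` would leave `2 |K_nm|² (2 - κ) E G ≥ 0`
(`exists_pair_nonneg`).

The replacement must cost only a relative error `O(1/N)`, uniformly in the pair, although `G` itself
degenerates when the two frequencies are close (`exists_curvatureForm_perturbation`). Two facts give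
this. The information matrix is bounded above and below by multiples of `N`, by linear independence
of the tones and a Riemann sum (`exists_powerInfo_bounds`). And the response at the two frequencies,
multiplied by their distance, is controlled by `ΔB` itself (`exists_abs_sub_mul_norm_response_le`).
All constants are independent of `K`, so one threshold serves every direction. -/

/-- The phase `e^{-j2πuτ}` that a delay `τ` causes at normalized frequency `u`. -/
def delayPhase (τ u : ℝ) : ℂ := Complex.exp (-(2 * Real.pi * Complex.I * u * τ))

/-- The gradient of `∑ β_l e^{-j2πuτ_l}` in the parameters `[τ, Re β, Im β]`. -/
def steering (τ : Fin L → ℝ) (β : Fin L → ℂ) (u : ℝ) : Param L → ℂ :=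
  Sum.elim (fun l => -(2 * Real.pi * Complex.I * u) * β l * delayPhase (τ l) u)
    (Sum.elim (fun l => delayPhase (τ l) u) (fun l => Complex.I * delayPhase (τ l) u))

/-- The response of the steering vector in the direction `w`. -/
def response (τ : Fin L → ℝ) (β : Fin L → ℂ) (w : Param L → ℝ) (u : ℝ) : ℂ :=
  ∑ k, steering τ β u k * (w k : ℂ)

/-- The information matrix of a single frequency. -/
def toneInfo (τ : Fin L → ℝ) (β : Fin L → ℂ) (u : ℝ) : Matrix (Param L) (Param L) ℝ :=
  Matrix.of fun k l => (star (steering τ β u k) * steering τ β u l).re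

/-- The information matrix of the power allocation `p` over the frequencies `n / N`. -/
def powerInfo (τ : Fin L → ℝ) (β : Fin L → ℂ) {N : ℕ} (p : Fin N → ℝ) :
    Matrix (Param L) (Param L) ℝ :=
  ∑ n : Fin N, p n • toneInfo τ β ((n : ℕ) / N : ℝ)

lemma norm_delayPhase (τ u : ℝ) : ‖delayPhase τ u‖ = 1 := by
  have : -(2 * Real.pi * Complex.I * u * τ : ℂ) = ((-(2 * Real.pi * u * τ) : ℝ) : ℂ) * Complex.I := by
    push_cast; ring
  rw [delayPhase, this, Complex.norm_exp_ofReal_mul_I]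

lemma delayPhase_mul_conj (τ u : ℝ) : delayPhase τ u * star (delayPhase τ u) = 1 := by
  have := Complex.mul_conj (delayPhase τ u)
  rw [Complex.normSq_eq_norm_sq, norm_delayPhase] at this
  simpa using this

lemma hasDerivAt_delayPhase (τ u : ℝ) :
    HasDerivAt (delayPhase τ) (-(2 * Real.pi * Complex.I * τ) * delayPhase τ u) u := by
  have h : HasDerivAt (fun u : ℝ => -(2 * Real.pi * Complex.I * u * τ : ℂ))
      (-(2 * Real.pi * Complex.I * τ)) u := by
    have := ((Complex.ofRealCLM.hasDerivAt (x := u)).const_mul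
      (2 * Real.pi * Complex.I)).mul_const (τ : ℂ)
    simpa using this.fun_neg
  have := h.cexp
  rwa [mul_comm (Complex.exp _)] at this

lemma response_eq (τ : Fin L → ℝ) (β : Fin L → ℂ) (w : Param L → ℝ) (u : ℝ) :
    response τ β w u = ∑ l, (-(2 * Real.pi * Complex.I * u) * β l * w (Sum.inl l)
      + (w (Sum.inr (Sum.inl l)) + Complex.I * w (Sum.inr (Sum.inr l)))) * delayPhase (τ l) u := by
  rw [response, Fintype.sum_sum_type, Fintype.sum_sum_type, ← sum_add_distrib, ← sum_add_distrib]
  refine sum_congr rfl fun l _ => ?_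
  simp only [steering, Sum.elim_inl, Sum.elim_inr]
  ring

lemma toneInfo_mulVec (τ : Fin L → ℝ) (β : Fin L → ℂ) (u : ℝ) (w : Param L → ℝ) (k : Param L) :
    (toneInfo τ β u *ᵥ w) k = (star (steering τ β u k) * response τ β w u).re := by
  rw [response, mul_sum, Complex.re_sum, Matrix.mulVec, dotProduct]
  refine sum_congr rfl fun l _ => ?_
  rw [toneInfo, Matrix.of_apply, ← mul_assoc, Complex.re_mul_ofReal]

lemma toneInfo_transpose (τ : Fin L → ℝ) (β : Fin L → ℂ) (u : ℝ) :
    (toneInfo τ β u)ᵀ = toneInfo τ β u := by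
  ext k l
  simp only [toneInfo, Matrix.transpose_apply, Matrix.of_apply, Complex.mul_re, Complex.star_def,
    Complex.conj_re, Complex.conj_im]
  ring

lemma dotProduct_toneInfo_mulVec (τ : Fin L → ℝ) (β : Fin L → ℂ) (u : ℝ) (w : Param L → ℝ) :
    w ⬝ᵥ (toneInfo τ β u *ᵥ w) = ‖response τ β w u‖ ^ 2 := by
  have h : ((‖response τ β w u‖ ^ 2 : ℝ) : ℂ) = star (response τ β w u) * response τ β w u := by
    rw [← Complex.normSq_eq_norm_sq, Complex.star_def, Complex.normSq_eq_conj_mul_self]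
  rw [← Complex.ofReal_re (‖response τ β w u‖ ^ 2), h]
  conv_rhs => enter [1, 1]; rw [response]
  rw [star_sum, sum_mul, Complex.re_sum]
  refine sum_congr rfl fun k _ => ?_
  rw [toneInfo_mulVec, star_mul, mul_assoc, Complex.star_def, Complex.conj_ofReal,
    Complex.re_ofReal_mul]

lemma powerInfo_transpose (τ : Fin L → ℝ) (β : Fin L → ℂ) {N : ℕ} (p : Fin N → ℝ) :
    (powerInfo τ β p)ᵀ = powerInfo τ β p := by
  simp [powerInfo, Matrix.transpose_sum, toneInfo_transpose]

lemma powerInfo_sub (τ : Fin L → ℝ) (β : Fin L → ℂ) {N : ℕ} (p q : Fin N → ℝ) :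
    powerInfo τ β p - powerInfo τ β q = powerInfo τ β (p - q) := by
  simp [powerInfo, sub_smul]

lemma dotProduct_powerInfo_mulVec (τ : Fin L → ℝ) (β : Fin L → ℂ) {N : ℕ} (p : Fin N → ℝ)
    (w : Param L → ℝ) : w ⬝ᵥ (powerInfo τ β p *ᵥ w) =
      ∑ n : Fin N, p n * ‖response τ β w ((n : ℕ) / N : ℝ)‖ ^ 2 := by
  rw [powerInfo, Matrix.sum_mulVec, dotProduct_sum]
  refine sum_congr rfl fun n _ => ?_
  rw [Matrix.smul_mulVec, dotProduct_smul, dotProduct_toneInfo_mulVec, smul_eq_mul]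

/-! ### Bounds on the unit interval -/

lemma exists_norm_steering_le (τ : Fin L → ℝ) (β : Fin L → ℂ) :
    ∃ C : ℝ, 0 < C ∧ ∀ u ∈ Set.Icc (0 : ℝ) 1, ∀ k, ‖steering τ β u k‖ ≤ C := by
  refine ⟨1 + 2 * Real.pi * ∑ l, ‖β l‖, by positivity, ?_⟩
  have h0 : 0 ≤ 2 * Real.pi * ∑ l, ‖β l‖ := by positivity
  rintro u hu (l | l | l)
  · have : ‖β l‖ ≤ ∑ l, ‖β l‖ := single_le_sum (f := fun l => ‖β l‖) (fun _ _ => norm_nonneg _) (mem_univ l)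
    simp only [steering, Sum.elim_inl, norm_mul, norm_neg, norm_delayPhase, Complex.norm_I,
      Complex.norm_real, mul_one, Complex.norm_ofNat, Real.norm_eq_abs, abs_of_pos Real.pi_pos,
      abs_of_nonneg hu.1]
    calc 2 * Real.pi * u * ‖β l‖ ≤ 2 * Real.pi * 1 * ‖β l‖ := by gcongr; exact hu.2
      _ ≤ _ := by rw [mul_one]; nlinarith [Real.pi_pos]
  · simp only [steering, Sum.elim_inr, Sum.elim_inl, norm_delayPhase]; linarith
  · simp only [steering, Sum.elim_inr, norm_mul, norm_delayPhase, Complex.norm_I]; linarith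

lemma norm_delayPhase_sub_le (τ u v : ℝ) :
    ‖delayPhase τ u - delayPhase τ v‖ ≤ 2 * Real.pi * |τ| * |u - v| := by
  have := convex_univ.norm_image_sub_le_of_norm_hasDerivWithin_le (f := delayPhase τ)
    (C := 2 * Real.pi * |τ|) (fun x _ => (hasDerivAt_delayPhase τ x).hasDerivWithinAt)
    (fun x _ => by
      simp [norm_delayPhase, abs_of_pos Real.pi_pos]) (Set.mem_univ v) (Set.mem_univ u)
  simpa using this

lemma exists_norm_steering_sub_le (τ : Fin L → ℝ) (β : Fin L → ℂ) :
    ∃ C : ℝ, 0 < C ∧ ∀ u ∈ Set.Icc (0 : ℝ) 1, ∀ v ∈ Set.Icc (0 : ℝ) 1, ∀ k,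
      ‖steering τ β u k - steering τ β v k‖ ≤ C * |u - v| := by
  set T := ∑ l, |τ l| with hT
  set D := ∑ l, ‖β l‖ with hD
  have hT0 : 0 ≤ T := sum_nonneg fun _ _ => abs_nonneg _
  have hD0 : 0 ≤ D := sum_nonneg fun _ _ => norm_nonneg _
  have hphase : ∀ u v l, ‖delayPhase (τ l) u - delayPhase (τ l) v‖ ≤ 2 * Real.pi * T * |u - v| := by
    intro u v l
    refine (norm_delayPhase_sub_le _ _ _).trans ?_
    have : |τ l| ≤ T := single_le_sum (f := fun l => |τ l|) (fun _ _ => abs_nonneg _) (mem_univ l)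
    gcongr
  refine ⟨1 + 2 * Real.pi * T + 2 * Real.pi * D * (1 + 2 * Real.pi * T), by positivity, ?_⟩
  intro u hu v hv k
  have hp : 0 ≤ 2 * Real.pi * D * (1 + 2 * Real.pi * T) := by positivity
  have hq : 0 ≤ 2 * Real.pi * T := by positivity
  have h0 := abs_nonneg (u - v)
  rcases k with l | l | l
  · have hl : ‖β l‖ ≤ D := single_le_sum (f := fun l => ‖β l‖) (fun _ _ => norm_nonneg _) (mem_univ l)
    have : steering τ β u (Sum.inl l) - steering τ β v (Sum.inl l) =
        -(2 * Real.pi * Complex.I) * β l * (((u - v : ℝ) : ℂ) * delayPhase (τ l) u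
          + (v : ℂ) * (delayPhase (τ l) u - delayPhase (τ l) v)) := by
      simp only [steering, Sum.elim_inl]; push_cast; ring
    rw [this, norm_mul, norm_mul, norm_neg, norm_mul, norm_mul]
    have h2 : ‖((u - v : ℝ) : ℂ) * delayPhase (τ l) u
          + (v : ℂ) * (delayPhase (τ l) u - delayPhase (τ l) v)‖
        ≤ (1 + 2 * Real.pi * T) * |u - v| := by
      refine (norm_add_le _ _).trans ?_
      rw [norm_mul, norm_mul, norm_delayPhase, Complex.norm_real, Complex.norm_real,
        Real.norm_eq_abs, Real.norm_eq_abs, abs_of_nonneg hv.1]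
      have := mul_le_mul hv.2 (hphase u v l) (norm_nonneg _) zero_le_one
      linarith
    simp only [Complex.norm_I, Complex.norm_real, mul_one, Complex.norm_ofNat, Real.norm_eq_abs,
      abs_of_pos Real.pi_pos]
    calc 2 * Real.pi * ‖β l‖ * _ ≤ 2 * Real.pi * D * ((1 + 2 * Real.pi * T) * |u - v|) := by
          gcongr
      _ ≤ _ := by nlinarith
  · simp only [steering, Sum.elim_inr, Sum.elim_inl]
    refine (hphase u v l).trans ?_
    nlinarith
  · simp only [steering, Sum.elim_inr]
    rw [← mul_sub, norm_mul, Complex.norm_I, one_mul]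
    refine (hphase u v l).trans ?_
    nlinarith

lemma norm_response_le (τ : Fin L → ℝ) (β : Fin L → ℂ) {C u : ℝ}
    (hC : ∀ k, ‖steering τ β u k‖ ≤ C) (w : Param L → ℝ) :
    ‖response τ β w u‖ ≤ Fintype.card (Param L) * C * ‖w‖ := by
  refine (norm_sum_le _ _).trans ?_
  calc ∑ k, ‖steering τ β u k * (w k : ℂ)‖ ≤ ∑ _k : Param L, C * ‖w‖ := by
        refine sum_le_sum fun k _ => ?_
        rw [norm_mul, Complex.norm_real]
        exact mul_le_mul (hC k) (norm_le_pi_norm w k) (norm_nonneg _) ((norm_nonneg _).trans (hC k))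
    _ = _ := by rw [sum_const, card_univ, nsmul_eq_mul]; ring

lemma norm_response_sub_le (τ : Fin L → ℝ) (β : Fin L → ℂ) {C u v : ℝ}
    (hC : ∀ k, ‖steering τ β u k - steering τ β v k‖ ≤ C) (w : Param L → ℝ) :
    ‖response τ β w u - response τ β w v‖ ≤ Fintype.card (Param L) * C * ‖w‖ := by
  rw [response, response, ← sum_sub_distrib]
  refine (norm_sum_le _ _).trans ?_
  calc ∑ k, ‖steering τ β u k * (w k : ℂ) - steering τ β v k * (w k : ℂ)‖
      ≤ ∑ _k : Param L, C * ‖w‖ := by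
        refine sum_le_sum fun k _ => ?_
        rw [← sub_mul, norm_mul, Complex.norm_real]
        exact mul_le_mul (hC k) (norm_le_pi_norm w k) (norm_nonneg _) ((norm_nonneg _).trans (hC k))
    _ = _ := by rw [sum_const, card_univ, nsmul_eq_mul]; ring

lemma norm_toneInfo_mulVec_le (τ : Fin L → ℝ) (β : Fin L → ℂ) {C u : ℝ} (hC0 : 0 ≤ C)
    (hC : ∀ k, ‖steering τ β u k‖ ≤ C) (w : Param L → ℝ) :
    ‖toneInfo τ β u *ᵥ w‖ ≤ C * ‖response τ β w u‖ := by
  refine (pi_norm_le_iff_of_nonneg (by positivity)).2 fun k => ?_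
  rw [toneInfo_mulVec, Real.norm_eq_abs]
  refine (Complex.abs_re_le_norm _).trans ?_
  rw [norm_mul, norm_star]
  gcongr
  exact hC k

/-! ### Linear independence of the tones -/

/-- Apply the differential operator `P(d/du)`: it turns `(c + d u) e^{xu}` into `((c + d u) P(x) + d
P'(x)) e^{xu}`. A polynomial with double zeros at all exponents but one isolates that one. -/
lemma eq_zero_of_exponential_sum_eq_zero {ι : Type*} [Fintype ι] [DecidableEq ι] (x c d : ι → ℂ)
    (hx : Function.Injective x)
    (h : ∀ u ∈ Set.Ioo (0 : ℝ) 1, ∑ l, (c l + d l * u) * Complex.exp (x l * u) = 0) :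
    c = 0 ∧ d = 0 := by
  have key : ∀ P : Polynomial ℂ, ∀ u ∈ Set.Ioo (0 : ℝ) 1,
      ∑ l, ((c l + d l * u) * P.eval (x l) + d l * P.derivative.eval (x l))
        * Complex.exp (x l * u) = 0 := by
    have step : ∀ P : Polynomial ℂ, (∀ u ∈ Set.Ioo (0 : ℝ) 1,
        ∑ l, ((c l + d l * u) * P.eval (x l) + d l * P.derivative.eval (x l))
          * Complex.exp (x l * u) = 0) → ∀ u ∈ Set.Ioo (0 : ℝ) 1,
        ∑ l, ((c l + d l * u) * (P * Polynomial.X).eval (x l)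
          + d l * (P * Polynomial.X).derivative.eval (x l)) * Complex.exp (x l * u) = 0 := by
      intro P hP u hu
      have hd : HasDerivAt (fun u : ℝ => ∑ l, ((c l + d l * u) * P.eval (x l)
          + d l * P.derivative.eval (x l)) * Complex.exp (x l * u))
          (∑ l, ((c l + d l * u) * (P * Polynomial.X).eval (x l)
          + d l * (P * Polynomial.X).derivative.eval (x l)) * Complex.exp (x l * u)) u := by
        refine HasDerivAt.fun_sum fun l _ => ?_
        have h1 : HasDerivAt (fun u : ℝ => (u : ℂ)) 1 u := Complex.ofRealCLM.hasDerivAt (x := u)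
        have h2 := (h1.const_mul (x l)).cexp
        have h3 := (((h1.const_mul (d l)).const_add (c l)).mul_const (P.eval (x l))).add_const
          (d l * P.derivative.eval (x l))
        refine (h3.fun_mul h2).congr_deriv ?_
        simp only [Polynomial.eval_mul, Polynomial.eval_X, Polynomial.derivative_mul,
          Polynomial.derivative_X, mul_one, Polynomial.eval_add]
        ring
      have hz : (fun u : ℝ => ∑ l, ((c l + d l * u) * P.eval (x l)
          + d l * P.derivative.eval (x l)) * Complex.exp (x l * u)) =ᶠ[𝓝 u] fun _ => 0 := by
        filter_upwards [isOpen_Ioo.mem_nhds hu] with v hv using hP v hv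
      exact (hd.congr_of_eventuallyEq hz.symm).unique (hasDerivAt_const u 0)
    intro P
    induction P using Polynomial.induction_on with
    | C a =>
      intro u hu
      rw [← mul_zero a, ← h u hu, mul_sum]
      refine sum_congr rfl fun l _ => ?_
      simp only [Polynomial.eval_C, Polynomial.derivative_C, Polynomial.eval_zero]
      ring
    | add p q hp hq =>
      intro u hu
      rw [← add_zero (0 : ℂ)]
      nth_rewrite 1 [← hp u hu]
      rw [← hq u hu, ← sum_add_distrib]
      refine sum_congr rfl fun l _ => ?_
      simp only [Polynomial.eval_add, Polynomial.derivative_add]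
      ring
    | monomial n a hn =>
      rw [pow_succ, ← mul_assoc]
      exact step _ hn
  let Q : ι → Polynomial ℂ := fun l => ∏ i ∈ univ.erase l, (Polynomial.X - Polynomial.C (x i))
  have hQ : ∀ l j, j ≠ l → (Q l).eval (x j) = 0 := by
    intro l j hj
    simp only [Q, Polynomial.eval_prod]
    exact prod_eq_zero (mem_erase.2 ⟨hj, mem_univ _⟩) (by simp)
  have hQl : ∀ l, (Q l).eval (x l) ≠ 0 := by
    intro l
    simp only [Q, Polynomial.eval_prod]
    refine prod_ne_zero_iff.2 fun j hj => ?_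
    simpa [sub_eq_zero] using fun h => (mem_erase.1 hj).1 (hx h).symm
  have hd : d = 0 := by
    funext l
    -- The polynomial vanishes doubly at the other exponents and simply at `x l`, so only the term
    -- `d l * (Q l)(x l)²` survives. Afterwards `Q l ^ 2` isolates `c l`.
    have := key (Q l ^ 2 * (Polynomial.X - Polynomial.C (x l))) (1 / 2) (by norm_num)
    rw [sum_eq_single l] at this
    · simpa [Polynomial.derivative_mul, hQl l, Polynomial.derivative_pow] using this
    · intro j _ hj
      simp [Polynomial.derivative_mul, Polynomial.derivative_pow, hQ l j hj]
    · simp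
  refine ⟨?_, hd⟩
  funext l
  have := key (Q l ^ 2) (1 / 2) (by norm_num)
  rw [sum_eq_single l] at this
  · simpa [hQl l, hd] using this
  · intro j _ hj
    simp [hQ l j hj, Polynomial.derivative_pow]
  · simp

/-- The response is an exponential sum with affine coefficients: the amplitude components of `w`
give the constant parts, the delay components the slopes. Distinct delays make the exponents
distinct, and `β l ≠ 0` lets the slope determine the delay component. -/
lemma eq_zero_of_response_eq_zero (τ : Fin L → ℝ) (hτ : Function.Injective τ) (β : Fin L → ℂ)
    (hβ : ∀ l, β l ≠ 0) (w : Param L → ℝ)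
    (h : ∀ u ∈ Set.Ioo (0 : ℝ) 1, response τ β w u = 0) : w = 0 := by
  have hpi : (2 * Real.pi * Complex.I : ℂ) ≠ 0 := by
    simp [Real.pi_ne_zero]
  obtain ⟨h1, h2⟩ := eq_zero_of_exponential_sum_eq_zero
    (fun l => -(2 * Real.pi * Complex.I * τ l))
    (fun l => (w (Sum.inr (Sum.inl l)) : ℂ) + Complex.I * w (Sum.inr (Sum.inr l)))
    (fun l => -(2 * Real.pi * Complex.I) * β l * w (Sum.inl l))
    (by
      intro a b hab
      have := mul_left_cancel₀ hpi (neg_injective hab)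
      exact hτ (Complex.ofReal_injective this))
    (by
      intro u hu
      rw [← h u hu, response_eq]
      refine sum_congr rfl fun l _ => ?_
      rw [delayPhase]
      congr 1
      · ring
      · congr 1; ring)
  funext k
  rcases k with l | l | l
  · have := congrFun h2 l
    simpa [hβ l, Real.pi_ne_zero] using this
  · have := congrArg Complex.re (congrFun h1 l)
    simpa using this
  · have := congrArg Complex.im (congrFun h1 l)
    simpa using this

/-! ### Coercivity of the information matrix -/

/-- Left Riemann sum of a `K`-Lipschitz function: each of the `N` cells contributes an error of at
most `K / N`, so the unnormalized sum is off by a bounded amount. -/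
lemma abs_sum_sub_integral_le (h : ℝ → ℝ) (hc : Continuous h) (K : ℝ)
    (hK : ∀ u ∈ Set.Icc (0 : ℝ) 1, ∀ v ∈ Set.Icc (0 : ℝ) 1, |h u - h v| ≤ K * |u - v|)
    (N : ℕ) (hN : 0 < N) :
    |∑ n : Fin N, h ((n : ℕ) / N : ℝ) - N * ∫ u in (0 : ℝ)..1, h u| ≤ K := by
  have hN' : (0 : ℝ) < N := by exact_mod_cast hN
  have hK0 : 0 ≤ K := by
    have := (abs_nonneg _).trans (hK 0 (by simp) 1 (by simp))
    simpa using this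
  have hsplit : ∫ u in (0 : ℝ)..1, h u =
      ∑ k ∈ range N, ∫ u in ((k : ℝ) / N)..((k + 1 : ℕ) / N : ℝ), h u := by
    rw [intervalIntegral.sum_integral_adjacent_intervals
      (a := fun k : ℕ => (k : ℝ) / N) (fun k _ => hc.intervalIntegrable _ _)]
    simp [hN'.ne']
  rw [Fin.sum_univ_eq_sum_range (fun n => h ((n : ℝ) / N)) N, hsplit, mul_sum, ← sum_sub_distrib]
  refine (abs_sum_le_sum_abs _ _).trans ?_
  calc ∑ k ∈ range N, |h ((k : ℝ) / N) - N * ∫ u in ((k : ℝ) / N)..((k + 1 : ℕ) / N : ℝ), h u|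
      ≤ ∑ _k ∈ range N, K / N := by
        refine sum_le_sum fun k hk => ?_
        have hkN : k < N := mem_range.1 hk
        have hk1 : ((k + 1 : ℕ) : ℝ) ≤ N := by exact_mod_cast hkN
        have hlen : ((k + 1 : ℕ) / N : ℝ) - (k : ℝ) / N = 1 / N := by push_cast; ring
        have hle : (k : ℝ) / N ≤ ((k + 1 : ℕ) / N : ℝ) := by
          have : (0 : ℝ) < 1 / N := by positivity
          linarith
        have hmem : ∀ u ∈ Set.Icc ((k : ℝ) / N) ((k + 1 : ℕ) / N : ℝ), u ∈ Set.Icc (0 : ℝ) 1 := by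
          intro u hu
          refine ⟨le_trans (by positivity) hu.1, hu.2.trans ?_⟩
          rw [div_le_one hN']
          exact hk1
        have heq : h ((k : ℝ) / N) - N * ∫ u in ((k : ℝ) / N)..((k + 1 : ℕ) / N : ℝ), h u
            = N * ∫ u in ((k : ℝ) / N)..((k + 1 : ℕ) / N : ℝ), (h ((k : ℝ) / N) - h u) := by
          rw [intervalIntegral.integral_sub (by simp) (hc.intervalIntegrable _ _),
            intervalIntegral.integral_const, hlen, smul_eq_mul]
          field_simp
        have hint := intervalIntegral.norm_integral_le_of_norm_le_const
          (f := fun u => h ((k : ℝ) / N) - h u) (a := (k : ℝ) / N) (b := ((k + 1 : ℕ) / N : ℝ))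
          (C := K * (1 / N)) (by
            intro u hu
            rw [Set.uIoc_of_le hle] at hu
            have hu' : u ∈ Set.Icc ((k : ℝ) / N) ((k + 1 : ℕ) / N : ℝ) := ⟨hu.1.le, hu.2⟩
            refine (hK _ (hmem _ (Set.left_mem_Icc.2 hle)) _ (hmem _ hu')).trans ?_
            gcongr
            rw [abs_sub_comm, abs_of_nonneg (by linarith [hu.1])]
            linarith [hu.2])
        rw [heq, abs_mul, abs_of_pos hN']
        rw [Real.norm_eq_abs, hlen, abs_of_pos (by positivity : (0 : ℝ) < 1 / N)] at hint
        calc (N : ℝ) * _ ≤ N * (K * (1 / N) * (1 / N)) := by gcongr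
          _ = K / N := by field_simp
    _ = K := by rw [sum_const, card_range, nsmul_eq_mul]; field_simp

lemma continuous_response (τ : Fin L → ℝ) (β : Fin L → ℂ) :
    Continuous fun x : (Param L → ℝ) × ℝ => response τ β x.1 x.2 := by
  simp only [response_eq, delayPhase]
  fun_prop

lemma response_smul (τ : Fin L → ℝ) (β : Fin L → ℂ) (r : ℝ) (w : Param L → ℝ) (u : ℝ) :
    response τ β (r • w) u = r * response τ β w u := by
  rw [response, response, mul_sum]
  refine sum_congr rfl fun k _ => ?_
  simp only [Pi.smul_apply, smul_eq_mul, Complex.ofReal_mul]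
  ring

/-- The integral of `|response|²` is positive for `w ≠ 0` by linear independence, hence bounded
below on the compact unit sphere. The sum over the tones is `N` times this integral up to a bounded
error, which half of the main term absorbs for large `N`; homogeneity extends the bound to all `w`.
-/
lemma exists_coercive (τ : Fin L → ℝ) (hτ : Function.Injective τ) (β : Fin L → ℂ)
    (hβ : ∀ l, β l ≠ 0) : ∃ c : ℝ, 0 < c ∧ ∃ N₀ : ℕ, 0 < N₀ ∧ ∀ N ≥ N₀, ∀ w : Param L → ℝ,
      c * N * ‖w‖ ^ 2 ≤ ∑ n : Fin N, ‖response τ β w ((n : ℕ) / N : ℝ)‖ ^ 2 := by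
  -- For `L = 0` the unit sphere is empty and there is no minimizer.
  rcases isEmpty_or_nonempty (Param L) with hE | hE
  · refine ⟨1, one_pos, 1, one_pos, fun N _ w => ?_⟩
    rw [Subsingleton.elim w 0]
    rw [norm_zero, zero_pow two_ne_zero, mul_zero]
    positivity
  have hcont := continuous_response τ β
  let I : (Param L → ℝ) → ℝ := fun w => ∫ u in (0 : ℝ)..1, ‖response τ β w u‖ ^ 2
  have hI : Continuous I :=
    intervalIntegral.continuous_parametric_intervalIntegral_of_continuous'
      (f := fun w u => ‖response τ β w u‖ ^ 2) (by
        change Continuous fun x : (Param L → ℝ) × ℝ => ‖response τ β x.1 x.2‖ ^ 2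
        exact hcont.norm.pow 2) 0 1
  obtain ⟨w₀, hw₀, hmin⟩ := (isCompact_sphere (0 : Param L → ℝ) 1).exists_isMinOn
    (NormedSpace.sphere_nonempty.2 zero_le_one) hI.continuousOn
  have hone : ∀ w, Continuous fun u => ‖response τ β w u‖ ^ 2 := fun w =>
    (hcont.comp (Continuous.prodMk_right w)).norm.pow 2
  have hpos : 0 < I w₀ := by
    refine intervalIntegral.integral_pos one_pos (hone w₀).continuousOn
      (fun u _ => by positivity) ?_
    by_contra! hcon
    have hzero : w₀ = 0 := by
      refine eq_zero_of_response_eq_zero τ hτ β hβ w₀ fun u hu => ?_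
      have := hcon u ⟨hu.1.le, hu.2.le⟩
      have h2 : ‖response τ β w₀ u‖ ^ 2 = 0 := le_antisymm this (by positivity)
      simpa using h2
    rw [hzero] at hw₀
    simp at hw₀
  obtain ⟨C₀, hC₀, hb₀⟩ := exists_norm_steering_le τ β
  obtain ⟨C₁, hC₁, hb₁⟩ := exists_norm_steering_sub_le τ β
  set d : ℝ := (Fintype.card (Param L) : ℝ) with hd
  have hd0 : 0 ≤ d := by positivity
  set K := 2 * (d * C₀) * (d * C₁) with hKdef
  -- The threshold is chosen so that the Riemann error `K` is at most `N * I w₀ / 2`.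
  refine ⟨I w₀ / 2, by positivity, ⌈2 * K / I w₀⌉₊ + 1, by omega, fun N hN w => ?_⟩
  have hNpos : 0 < N := by omega
  have hN' : (0 : ℝ) < N := by exact_mod_cast hNpos
  have hunit : ∀ w : Param L → ℝ, ‖w‖ = 1 →
      I w₀ / 2 * N ≤ ∑ n : Fin N, ‖response τ β w ((n : ℕ) / N : ℝ)‖ ^ 2 := by
    intro w hw
    have hlip : ∀ u ∈ Set.Icc (0 : ℝ) 1, ∀ v ∈ Set.Icc (0 : ℝ) 1,
        |‖response τ β w u‖ ^ 2 - ‖response τ β w v‖ ^ 2| ≤ K * |u - v| := by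
      intro u hu v hv
      have h1 := norm_response_le τ β (hb₀ u hu) w
      have h2 := norm_response_le τ β (hb₀ v hv) w
      have h3 := norm_response_sub_le τ β (hb₁ u hu v hv) w
      rw [hw, mul_one] at h1 h2 h3
      have h4 := abs_norm_sub_norm_le (response τ β w u) (response τ β w v)
      rw [sq_sub_sq, abs_mul, abs_of_nonneg (by positivity)]
      calc _ ≤ (2 * (d * C₀)) * (d * (C₁ * |u - v|)) := by
            apply mul_le_mul _ (h4.trans h3) (abs_nonneg _) (by positivity)
            linarith
        _ = _ := by rw [hKdef]; ring
    have hR := abs_sum_sub_integral_le _ (hone w) K hlip N hNpos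
    have hge : I w₀ ≤ I w := hmin (by simpa using hw)
    have hNK : K ≤ I w₀ / 2 * N := by
      have h5 : 2 * K / I w₀ ≤ N := by
        refine (Nat.le_ceil _).trans ?_
        exact_mod_cast (by omega : ⌈2 * K / I w₀⌉₊ ≤ N)
      rw [div_le_iff₀ hpos] at h5
      linarith
    have h6 := (abs_le.1 hR).1
    have h7 : (N : ℝ) * I w₀ ≤ N * I w := by gcongr
    have h8 : (N : ℝ) * I w = N * ∫ u in (0 : ℝ)..1, ‖response τ β w u‖ ^ 2 := rfl
    linarith
  rcases eq_or_ne w 0 with rfl | hw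
  · simp only [norm_zero]
    have : 0 ≤ ∑ n : Fin N, ‖response τ β (0 : Param L → ℝ) ((n : ℕ) / N : ℝ)‖ ^ 2 := by positivity
    simpa using this
  · have hw' : ‖w‖ ≠ 0 := norm_ne_zero_iff.2 hw
    have h := hunit (‖w‖⁻¹ • w) (by rw [norm_smul, norm_inv, norm_norm, inv_mul_cancel₀ hw'])
    simp only [response_smul, norm_mul, mul_pow, ← mul_sum] at h
    rw [Complex.norm_real, norm_inv, norm_norm] at h
    have h9 := mul_le_mul_of_nonneg_right h (sq_nonneg ‖w‖)
    calc _ ≤ _ := h9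
      _ = _ := by field_simp

/-- Two-sided quadratic bounds for the information matrix of a bounded power allocation. -/
lemma exists_powerInfo_bounds (τ : Fin L → ℝ) (hτ : Function.Injective τ) (β : Fin L → ℂ)
    (hβ : ∀ l, β l ≠ 0) {ρ₁ ρ₂ : ℝ} (hρ₁ : 0 < ρ₁) :
    ∃ c : ℝ, 0 < c ∧ ∃ C : ℝ, 0 < C ∧ ∃ N₀ : ℕ, 0 < N₀ ∧ ∀ N ≥ N₀, ∀ p : Fin N → ℝ,
      (∀ n, p n ∈ Set.Icc ρ₁ ρ₂) → ∀ w : Param L → ℝ,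
        c * N * ‖w‖ ^ 2 ≤ w ⬝ᵥ (powerInfo τ β p *ᵥ w) ∧
        ‖powerInfo τ β p *ᵥ w‖ ≤ C * N * ‖w‖ := by
  obtain ⟨c, hc, N₀, hN₀, h⟩ := exists_coercive τ hτ β hβ
  obtain ⟨C₀, hC₀, hb₀⟩ := exists_norm_steering_le τ β
  set d : ℝ := (Fintype.card (Param L) : ℝ) with hd
  have hd0 : 0 ≤ d := by positivity
  refine ⟨ρ₁ * c, by positivity, |ρ₂| * (C₀ * (d * C₀)) + 1, by positivity, N₀, hN₀,
    fun N hN p hp w => ⟨?_, ?_⟩⟩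
  · rw [dotProduct_powerInfo_mulVec]
    calc ρ₁ * c * N * ‖w‖ ^ 2 = ρ₁ * (c * N * ‖w‖ ^ 2) := by ring
      _ ≤ ρ₁ * ∑ n : Fin N, ‖response τ β w ((n : ℕ) / N : ℝ)‖ ^ 2 := by
        gcongr; exact h N hN w
      _ = ∑ n : Fin N, ρ₁ * ‖response τ β w ((n : ℕ) / N : ℝ)‖ ^ 2 := mul_sum _ _ _
      _ ≤ _ := sum_le_sum fun n _ => by gcongr; exact (hp n).1
  · rw [powerInfo, Matrix.sum_mulVec]
    refine (norm_sum_le _ _).trans ?_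
    calc _ ≤ ∑ _n : Fin N, |ρ₂| * (C₀ * (d * C₀ * ‖w‖)) := by
          refine sum_le_sum fun n _ => ?_
          have hn : ((n : ℕ) / N : ℝ) ∈ Set.Icc (0 : ℝ) 1 :=
            ⟨by positivity, div_le_one_of_le₀ (by exact_mod_cast n.2.le) (by positivity)⟩
          rw [Matrix.smul_mulVec, norm_smul, Real.norm_eq_abs]
          have h1 := norm_toneInfo_mulVec_le τ β hC₀.le (hb₀ _ hn) w
          have h2 := norm_response_le τ β (hb₀ _ hn) w
          have h3 : |p n| ≤ |ρ₂| := by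
            have h4 := (hp n).2
            have h5 := hρ₁.trans_le (hp n).1
            rw [abs_of_pos h5]
            exact h4.trans (le_abs_self _)
          have h6 : C₀ * ‖response τ β w ((n : ℕ) / N : ℝ)‖ ≤ C₀ * (d * C₀ * ‖w‖) := by gcongr
          exact mul_le_mul h3 (h1.trans h6) (norm_nonneg _) (abs_nonneg _)
      _ = |ρ₂| * (C₀ * (d * C₀)) * (N * ‖w‖) := by
          rw [sum_const, card_univ, Fintype.card_fin, nsmul_eq_mul]; ring
      _ ≤ _ := by
          have : 0 ≤ (N : ℝ) * ‖w‖ := by positivity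
          nlinarith

/-! ### Separation of the responses at two frequencies -/

lemma steering_re_row (τ : Fin L → ℝ) (β : Fin L → ℂ) (u : ℝ) (w : Param L → ℝ) (j : Fin L) :
    (toneInfo τ β u *ᵥ w) (Sum.inr (Sum.inl j)) =
      (star (delayPhase (τ j) u) * response τ β w u).re := by
  rw [toneInfo_mulVec]; rfl

lemma steering_im_row (τ : Fin L → ℝ) (β : Fin L → ℂ) (u : ℝ) (w : Param L → ℝ) (j : Fin L) :
    (toneInfo τ β u *ᵥ w) (Sum.inr (Sum.inr j)) =
      (star (delayPhase (τ j) u) * response τ β w u).im := by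
  rw [toneInfo_mulVec]
  simp only [steering, Sum.elim_inr, star_mul, Complex.star_def, Complex.conj_I]
  simp only [Complex.mul_re, Complex.neg_re, Complex.neg_im, Complex.I_re, Complex.I_im,
    Complex.mul_im]
  ring

lemma steering_delay_row (τ : Fin L → ℝ) (β : Fin L → ℂ) (u : ℝ) (w : Param L → ℝ) (j : Fin L) :
    (toneInfo τ β u *ᵥ w) (Sum.inl j) =
      -(2 * Real.pi * (u * (star (β j) * (star (delayPhase (τ j) u) * response τ β w u)).im)) := by
  rw [toneInfo_mulVec]
  have : star (steering τ β u (Sum.inl j)) * response τ β w u =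
      ((2 * Real.pi * u : ℝ) : ℂ) *
        (Complex.I * (star (β j) * (star (delayPhase (τ j) u) * response τ β w u))) := by
    simp only [steering, Sum.elim_inl, star_mul, star_neg, Complex.star_def, Complex.conj_I,
      Complex.conj_ofReal, map_ofNat]
    push_cast
    ring
  rw [this, Complex.re_ofReal_mul, Complex.I_mul_re]
  ring

/-- If the information matrices of two frequencies act almost equally on the vectors `V l`, whose
delay block is coercive, then these vectors have a small response at both frequencies, relative to
the distance of the frequencies. -/
lemma exists_abs_sub_mul_norm_response_le (τ : Fin L → ℝ) (β : Fin L → ℂ) (hβ : ∀ l, β l ≠ 0)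
    {c R : ℝ} (hc : 0 < c) (hR : 0 ≤ R) :
    ∃ C : ℝ, 0 < C ∧ ∀ u ∈ Set.Icc (0 : ℝ) 1, ∀ v ∈ Set.Icc (0 : ℝ) 1,
      ∀ V : Fin L → Param L → ℝ, (∀ l, ‖V l‖ ≤ R) →
      (∀ y : Fin L → ℝ, c * ‖y‖ ≤ ‖fun l => ∑ j, V l (Sum.inl j) * y j‖) →
      ∀ ε : ℝ, (∀ l, ‖toneInfo τ β u *ᵥ V l - toneInfo τ β v *ᵥ V l‖ ≤ ε) →
      ∀ l, |u - v| * ‖response τ β (V l) u‖ ≤ C * ε := by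
  obtain ⟨C₀, hC₀, hb₀⟩ := exists_norm_steering_le τ β
  set D := ∑ l, ‖β l‖ with hD
  set Bi := ∑ l, ‖β l‖⁻¹ with hBi
  have hD0 : 0 ≤ D := sum_nonneg fun _ _ => norm_nonneg _
  have hBi0 : 0 ≤ Bi := sum_nonneg fun _ _ => by positivity
  set Φ := (Fintype.card (Param L) : ℝ) * C₀ * R with hΦ
  have hΦ0 : 0 ≤ Φ := by positivity
  set G := (2 * Real.pi * D + 2) * R with hG
  have hG0 : 0 ≤ G := by positivity
  set C₂ := 2 * Φ + L * (G * 4) with hC₂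
  have hC₂0 : 0 ≤ C₂ := by positivity
  have hβD : ∀ j, ‖β j‖ ≤ D := fun j =>
    single_le_sum (f := fun l => ‖β l‖) (fun _ _ => norm_nonneg _) (mem_univ j)
  refine ⟨Bi * (C₂ / c + (1 + 2 * D)) + 1, by positivity, ?_⟩
  intro u hu v hv V hV hcoer ε hε l₀
  have hε0 : 0 ≤ ε := (norm_nonneg _).trans (hε l₀)
  set E := fun j => delayPhase (τ j) u with hE
  set E' := fun j => delayPhase (τ j) v with hE'
  set φ := fun l => response τ β (V l) u with hφ
  set φ' := fun l => response τ β (V l) v with hφ'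
  have hnE : ∀ j, ‖E j‖ = 1 := fun j => norm_delayPhase _ _
  have hnE' : ∀ j, ‖E' j‖ = 1 := fun j => norm_delayPhase _ _
  have hEE : ∀ j, E j * star (E j) = 1 := fun j => delayPhase_mul_conj _ _
  have hEE' : ∀ j, E' j * star (E' j) = 1 := fun j => delayPhase_mul_conj _ _
  have hrow : ∀ l k, |(toneInfo τ β u *ᵥ V l) k - (toneInfo τ β v *ᵥ V l) k| ≤ ε := fun l k =>
    (norm_le_pi_norm (toneInfo τ β u *ᵥ V l - toneInfo τ β v *ᵥ V l) k).trans (hε l)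
  have hφΦ : ∀ l, ‖φ l‖ ≤ Φ := fun l =>
    (norm_response_le τ β (hb₀ u hu) (V l)).trans (by rw [hΦ]; gcongr; exact hV l)
  -- The two amplitude rows are the real and imaginary parts of `conj(E j) * φ l`. Their near
  -- equality at `u` and `v` says that passing from `u` to `v` changes every phase `E j` almost like
  -- the response.
  have h1 : ∀ l j, ‖star (E j) * φ l - star (E' j) * φ' l‖ ≤ 2 * ε := by
    intro l j
    refine (Complex.norm_le_abs_re_add_abs_im _).trans ?_
    have hre := hrow l (Sum.inr (Sum.inl j))
    have him := hrow l (Sum.inr (Sum.inr j))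
    rw [steering_re_row, steering_re_row, ← Complex.sub_re] at hre
    rw [steering_im_row, steering_im_row, ← Complex.sub_im] at him
    linarith
  -- The delay row carries the extra factor `u` or `v`, while the quantity it multiplies is nearly
  -- the same at both frequencies by `h1`. The difference of rows thus exposes `u - v`, but only on
  -- an imaginary part.
  have h2 : ∀ l j, |u - v| * |(star (β j) * (star (E j) * φ l)).im| ≤ (1 + 2 * D) * ε := by
    intro l j
    have hd := hrow l (Sum.inl j)
    rw [steering_delay_row, steering_delay_row] at hd
    set X := star (β j) * (star (E j) * φ l) with hX
    set X' := star (β j) * (star (E' j) * φ' l) with hX'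
    have hd' : 2 * Real.pi * |u * X.im - v * X'.im| ≤ ε := by
      have : -(2 * Real.pi * (u * X.im)) - -(2 * Real.pi * (v * X'.im)) =
        -((2 * Real.pi) * (u * X.im - v * X'.im)) := by ring
      rw [this, abs_neg, abs_mul, abs_of_pos (by positivity)] at hd
      exact hd
    have hpi : (1 : ℝ) ≤ 2 * Real.pi := by linarith [Real.pi_gt_three]
    have hd2 : |u * X.im - v * X'.im| ≤ ε := by
      refine le_trans ?_ hd'
      exact le_mul_of_one_le_left (abs_nonneg _) hpi
    have hXX : |(X - X').im| ≤ D * (2 * ε) := by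
      refine (Complex.abs_im_le_norm _).trans ?_
      rw [hX, hX', ← mul_sub, norm_mul, norm_star]
      exact mul_le_mul (hβD j) (h1 l j) (norm_nonneg _) hD0
    rw [← abs_mul]
    have : (u - v) * X.im = (u * X.im - v * X'.im) - v * (X - X').im := by
      rw [Complex.sub_im]; ring
    rw [this]
    refine (abs_sub _ _).trans ?_
    rw [abs_mul, abs_of_nonneg hv.1]
    have : v * |(X - X').im| ≤ 1 * (D * (2 * ε)) :=
      mul_le_mul hv.2 hXX (abs_nonneg _) zero_le_one
    linarith
  set F := φ l₀ with hF
  set κ := E l₀ * star (E' l₀) with hκ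
  have h3a : ∀ j, ‖E' j * star (E j) * F - φ' l₀‖ ≤ 2 * ε := by
    intro j
    have : E' j * star (E j) * F - φ' l₀ = E' j * (star (E j) * φ l₀ - star (E' j) * φ' l₀) := by
      rw [mul_sub, ← mul_assoc, ← mul_assoc, hEE', one_mul]
    rw [this, norm_mul, hnE', one_mul]
    exact h1 l₀ j
  -- Weighted by the response `F`, all phases rotate by the common factor `κ`: each ratio of phases
  -- is compared with `φ' l₀`, which does not depend on `j`.
  have h3 : ∀ j, ‖E j - κ * E' j‖ * ‖F‖ ≤ 4 * ε := by
    intro j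
    have e1 : E j - κ * E' j = star (E' j * star (E j) - E' l₀ * star (E l₀)) * E' j := by
      simp only [hκ, star_sub, star_mul, star_star]
      linear_combination (-(E j)) * hEE' j
    rw [e1, norm_mul, norm_star, hnE', mul_one, ← norm_mul, sub_mul]
    have := norm_sub_le_norm_sub_add_norm_sub (E' j * star (E j) * F) (φ' l₀)
      (E' l₀ * star (E l₀) * F)
    have ha := h3a j
    have hb := h3a l₀
    rw [norm_sub_rev] at hb
    linarith
  have h4a : ∀ l, ‖φ l - κ * φ' l‖ ≤ 2 * ε := by
    intro l
    have : φ l - κ * φ' l = E l₀ * (star (E l₀) * φ l - star (E' l₀) * φ' l) := by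
      rw [mul_sub, ← mul_assoc, hEE, one_mul, ← mul_assoc]
    rw [this, norm_mul, hnE, one_mul]
    exact h1 l l₀
  -- The number `y l₀` is the conjugate of the quantity in `h2`, so its imaginary part is already
  -- under control. The real part is obtained from all `V l` together, through the coercive delay
  -- block.
  set y := fun j => β j * E j * star F with hy
  have h4 : ∀ l, ‖∑ j, (u - v : ℝ) * (V l (Sum.inl j) : ℂ) * y j‖ ≤ C₂ * ε := by
    intro l
    set g := fun j => -(2 * Real.pi * Complex.I * v) * β j * V l (Sum.inl j)
      + (V l (Sum.inr (Sum.inl j)) + Complex.I * V l (Sum.inr (Sum.inr j))) with hg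
    have hgn : ∀ j, ‖g j‖ ≤ G := by
      intro j
      have hv0 : ‖(v : ℂ)‖ ≤ 1 := by
        rw [Complex.norm_real, Real.norm_eq_abs, abs_of_nonneg hv.1]; exact hv.2
      have hVn : ∀ k, ‖(V l k : ℂ)‖ ≤ R := fun k => by
        rw [Complex.norm_real]; exact (norm_le_pi_norm _ _).trans (hV l)
      calc ‖g j‖ ≤ ‖-(2 * Real.pi * Complex.I * v) * β j * V l (Sum.inl j)‖ +
            (‖(V l (Sum.inr (Sum.inl j)) : ℂ)‖ + ‖Complex.I * V l (Sum.inr (Sum.inr j))‖) :=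
            (norm_add_le _ _).trans (by gcongr; exact norm_add_le _ _)
        _ = 2 * Real.pi * ‖(v : ℂ)‖ * ‖β j‖ * ‖(V l (Sum.inl j) : ℂ)‖ +
            (‖(V l (Sum.inr (Sum.inl j)) : ℂ)‖ + ‖(V l (Sum.inr (Sum.inr j)) : ℂ)‖) := by
            simp only [norm_mul, norm_neg, Complex.norm_I, Complex.norm_ofNat, mul_one, one_mul]
            rw [Complex.norm_real Real.pi, Real.norm_eq_abs, abs_of_pos Real.pi_pos]
        _ ≤ 2 * Real.pi * 1 * D * R + (R + R) := by
            gcongr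
            · exact hβD j
            · exact hVn _
            · exact hVn _
            · exact hVn _
        _ = G := by rw [hG]; ring
    -- If the phases rotated exactly by `κ`, then `φ l - κ * φ' l` would retain only the change of
    -- the factor `u` in the delay terms. Solving for this change leaves terms that `h3` and `h4a`
    -- make small.
    have hid : 2 * Real.pi * Complex.I * ∑ j, (u - v : ℝ) * (V l (Sum.inl j) : ℂ) * y j =
        ∑ j, g j * ((E j - κ * E' j) * star F) - (φ l - κ * φ' l) * star F := by
      simp only [hφ, hφ', response_eq]
      rw [mul_sum, mul_sum, ← sum_sub_distrib, sum_mul, ← sum_sub_distrib]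
      refine sum_congr rfl fun j _ => ?_
      simp only [hg, hy, hE, hE']
      push_cast
      ring
    have hn : 2 * Real.pi * ‖∑ j, (u - v : ℝ) * (V l (Sum.inl j) : ℂ) * y j‖ ≤ C₂ * ε := by
      have e2 : 2 * Real.pi * ‖∑ j, (u - v : ℝ) * (V l (Sum.inl j) : ℂ) * y j‖ =
          ‖2 * Real.pi * Complex.I * ∑ j, (u - v : ℝ) * (V l (Sum.inl j) : ℂ) * y j‖ := by
        rw [norm_mul]
        simp only [norm_mul, Complex.norm_I, Complex.norm_ofNat, mul_one]
        rw [Complex.norm_real Real.pi, Real.norm_eq_abs, abs_of_pos Real.pi_pos]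
      rw [e2, hid]
      refine (norm_sub_le _ _).trans ?_
      have e3 : ‖∑ j, g j * ((E j - κ * E' j) * star F)‖ ≤ L * (G * (4 * ε)) := by
        refine (norm_sum_le _ _).trans ?_
        calc _ ≤ ∑ _j : Fin L, G * (4 * ε) := by
              refine sum_le_sum fun j _ => ?_
              rw [norm_mul, norm_mul, norm_star]
              exact mul_le_mul (hgn j) (h3 j) (by positivity) hG0
          _ = _ := by rw [sum_const, card_univ, Fintype.card_fin, nsmul_eq_mul]
      have e4 : ‖(φ l - κ * φ' l) * star F‖ ≤ 2 * ε * Φ := by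
        rw [norm_mul, norm_star]
        exact mul_le_mul (h4a l) (hφΦ l₀) (norm_nonneg _) (by positivity)
      rw [hC₂]
      linarith
    have hpi : (1 : ℝ) ≤ 2 * Real.pi := by linarith [Real.pi_gt_three]
    exact (le_mul_of_one_le_left (norm_nonneg _) hpi).trans hn
  set Y : Fin L → ℝ := fun j => (u - v) * (y j).re with hY
  -- The entries of `V` are real, so taking real parts commutes with the sum against them.
  have h5 : c * ‖Y‖ ≤ C₂ * ε := by
    refine (hcoer Y).trans ((pi_norm_le_iff_of_nonneg (by positivity)).2 fun l => ?_)
    refine le_trans ?_ (h4 l)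
    have : ∑ j, V l (Sum.inl j) * Y j =
        (∑ j, (u - v : ℝ) * (V l (Sum.inl j) : ℂ) * y j).re := by
      rw [Complex.re_sum]
      refine sum_congr rfl fun j _ => ?_
      rw [← Complex.ofReal_mul, Complex.re_ofReal_mul, hY]
      ring
    rw [this]
    exact Complex.abs_re_le_norm _
  have h6 : |u - v| * |(y l₀).re| ≤ C₂ / c * ε := by
    have e5 : |u - v| * |(y l₀).re| ≤ ‖Y‖ := by
      rw [← abs_mul]; exact norm_le_pi_norm Y l₀
    refine e5.trans ?_
    rw [div_mul_eq_mul_div, le_div_iff₀ hc]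
    linarith
  have h7 : |u - v| * |(y l₀).im| ≤ (1 + 2 * D) * ε := by
    refine le_trans (le_of_eq ?_) (h2 l₀ l₀)
    have : y l₀ = star (star (β l₀) * (star (E l₀) * φ l₀)) := by
      simp only [hy, star_mul, star_star, hF]; ring
    rw [this, Complex.star_def, Complex.conj_im, abs_neg]
  have h8 : |u - v| * ‖y l₀‖ ≤ (C₂ / c + (1 + 2 * D)) * ε := by
    have := mul_le_mul_of_nonneg_left (Complex.norm_le_abs_re_add_abs_im (y l₀)) (abs_nonneg (u - v))
    linarith
  have h9 : ‖y l₀‖ = ‖β l₀‖ * ‖F‖ := by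
    rw [hy]; simp only [norm_mul, norm_star, hnE, mul_one]
  have h10 : ‖β l₀‖⁻¹ ≤ Bi :=
    single_le_sum (f := fun l => ‖β l‖⁻¹) (fun _ _ => by positivity) (mem_univ l₀)
  have hβ0 : ‖β l₀‖ ≠ 0 := norm_ne_zero_iff.2 (hβ l₀)
  calc |u - v| * ‖F‖ = ‖β l₀‖⁻¹ * (|u - v| * ‖y l₀‖) := by rw [h9]; field_simp
    _ ≤ Bi * ((C₂ / c + (1 + 2 * D)) * ε) :=
        mul_le_mul h10 h8 (by positivity) hBi0
    _ ≤ _ := by linarith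

/-! ### Inverses of uniformly coercive matrices -/

/-- Vectors carry the supremum norm here, which accounts for the cardinality in this and later
constants. -/
lemma abs_dotProduct_le_card_mul {ι : Type*} [Fintype ι] (x y : ι → ℝ) :
    |x ⬝ᵥ y| ≤ Fintype.card ι * ‖x‖ * ‖y‖ := by
  refine (abs_sum_le_sum_abs _ _).trans ?_
  calc ∑ i, |x i * y i| ≤ ∑ _i : ι, ‖x‖ * ‖y‖ := by
        refine sum_le_sum fun i _ => ?_
        rw [abs_mul]
        exact mul_le_mul (norm_le_pi_norm x i) (norm_le_pi_norm y i) (abs_nonneg _) (norm_nonneg _)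
    _ = _ := by rw [sum_const, card_univ, nsmul_eq_mul]; ring

section Inverse

variable {ι : Type*} [Fintype ι] [DecidableEq ι] {J : Matrix ι ι ℝ} {a b : ℝ}

lemma isUnit_det_of_coercive (ha : 0 < a) (hJ : ∀ w, a * ‖w‖ ^ 2 ≤ w ⬝ᵥ (J *ᵥ w)) :
    IsUnit J.det := by
  rw [isUnit_iff_ne_zero]
  intro h
  obtain ⟨w, hw, hJw⟩ := Matrix.exists_mulVec_eq_zero_iff.2 h
  have := hJ w
  rw [hJw, dotProduct_zero] at this
  have h2 : 0 < ‖w‖ := norm_pos_iff.2 hw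
  have : 0 < a * ‖w‖ ^ 2 := by positivity
  linarith

lemma mulVec_inv_mulVec (h : IsUnit J.det) (x : ι → ℝ) : J *ᵥ (J⁻¹ *ᵥ x) = x := by
  rw [Matrix.mulVec_mulVec, Matrix.mul_nonsing_inv _ h, Matrix.one_mulVec]

lemma norm_inv_mulVec_le (ha : 0 < a) (hJ : ∀ w, a * ‖w‖ ^ 2 ≤ w ⬝ᵥ (J *ᵥ w)) (x : ι → ℝ) :
    ‖J⁻¹ *ᵥ x‖ ≤ Fintype.card ι / a * ‖x‖ := by
  have h := hJ (J⁻¹ *ᵥ x)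
  rw [mulVec_inv_mulVec (isUnit_det_of_coercive ha hJ)] at h
  have h2 := (le_abs_self _).trans (abs_dotProduct_le_card_mul (J⁻¹ *ᵥ x) x)
  rcases (norm_nonneg (J⁻¹ *ᵥ x)).eq_or_lt with h0 | h0
  · rw [← h0]; positivity
  · rw [div_mul_eq_mul_div, le_div_iff₀ ha]
    refine le_of_mul_le_mul_left ?_ h0
    calc _ = a * ‖J⁻¹ *ᵥ x‖ ^ 2 := by ring
      _ ≤ _ := h.trans h2
      _ = _ := by ring

/-- For `z = J⁻¹ x` the form is `z ⬝ᵥ J z ≥ a ‖z‖²`, and the upper bound on `J` gives `‖z‖ ≥ ‖x‖ /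
b`. -/
lemma le_dotProduct_inv_mulVec (ha : 0 < a) (hb : 0 < b)
    (hJ : ∀ w, a * ‖w‖ ^ 2 ≤ w ⬝ᵥ (J *ᵥ w)) (hJb : ∀ w, ‖J *ᵥ w‖ ≤ b * ‖w‖) (x : ι → ℝ) :
    a / b ^ 2 * ‖x‖ ^ 2 ≤ x ⬝ᵥ (J⁻¹ *ᵥ x) := by
  have h := hJ (J⁻¹ *ᵥ x)
  have h2 := hJb (J⁻¹ *ᵥ x)
  rw [mulVec_inv_mulVec (isUnit_det_of_coercive ha hJ)] at h h2
  rw [dotProduct_comm]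
  refine le_trans ?_ h
  rw [div_mul_eq_mul_div, div_le_iff₀ (by positivity)]
  calc a * ‖x‖ ^ 2 ≤ a * (b * ‖J⁻¹ *ᵥ x‖) ^ 2 := by gcongr
    _ = _ := by ring

lemma inv_sub_inv_eq {J' : Matrix ι ι ℝ} (h : IsUnit J.det) (h' : IsUnit J'.det) :
    J⁻¹ - J'⁻¹ = -(J⁻¹ * (J - J') * J'⁻¹) := by
  rw [mul_sub, sub_mul, Matrix.nonsing_inv_mul _ h, one_mul, mul_assoc,
    Matrix.mul_nonsing_inv _ h', mul_one, neg_sub]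

lemma inv_transpose_of_symm (h : Jᵀ = J) : (J⁻¹)ᵀ = J⁻¹ := by
  rw [Matrix.transpose_nonsing_inv, h]

end Inverse

/-! ### The curvature form of the ranging bound -/

/-- The partial trace over the delays. -/
def delayTrace (X : Matrix (Param L) (Param L) ℝ) : ℝ := ∑ l, X (Sum.inl l) (Sum.inl l)

/-- The partial trace of `Yᵀ W Y` over the delays. -/
def curvatureForm (W Y : Matrix (Param L) (Param L) ℝ) : ℝ := delayTrace (Yᵀ * W * Y)

lemma curvatureForm_eq (W Y : Matrix (Param L) (Param L) ℝ) :
    curvatureForm W Y = ∑ l : Fin L, (Y *ᵥ Pi.single (Sum.inl l) 1) ⬝ᵥ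
      (W *ᵥ (Y *ᵥ Pi.single (Sum.inl l) 1)) := by
  rw [curvatureForm, delayTrace]
  refine sum_congr rfl fun l _ => ?_
  rw [Matrix.mulVec_single_one, mul_assoc, Matrix.mul_apply, dotProduct]
  refine sum_congr rfl fun k _ => ?_
  rw [Matrix.transpose_apply, Matrix.mul_apply]
  rfl

lemma norm_toneInfo_sub_mulVec_le (τ : Fin L → ℝ) (β : Fin L → ℂ) :
    ∃ C : ℝ, 0 < C ∧ ∀ u ∈ Set.Icc (0 : ℝ) 1, ∀ v ∈ Set.Icc (0 : ℝ) 1, ∀ w : Param L → ℝ,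
      ‖(toneInfo τ β u - toneInfo τ β v) *ᵥ w‖ ≤ C * |u - v| * ‖w‖ := by
  obtain ⟨C₀, hC₀, hb₀⟩ := exists_norm_steering_le τ β
  obtain ⟨C₁, hC₁, hb₁⟩ := exists_norm_steering_sub_le τ β
  set d : ℝ := (Fintype.card (Param L) : ℝ) with hd
  have hd0 : 0 ≤ d := by positivity
  refine ⟨2 * d * C₀ * C₁ + 1, by positivity, fun u hu v hv w => ?_⟩
  refine (pi_norm_le_iff_of_nonneg (by positivity)).2 fun k => ?_
  rw [Matrix.sub_mulVec, Pi.sub_apply, toneInfo_mulVec, toneInfo_mulVec, ← Complex.sub_re]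
  refine (Complex.abs_re_le_norm _).trans ?_
  have h1 : ‖star (steering τ β u k) - star (steering τ β v k)‖ ≤ C₁ * |u - v| := by
    rw [← star_sub, norm_star]; exact hb₁ u hu v hv k
  have h2 := norm_response_le τ β (hb₀ u hu) w
  have h3 := norm_response_sub_le τ β (hb₁ u hu v hv) w
  have h4 : ‖star (steering τ β v k)‖ ≤ C₀ := by rw [norm_star]; exact hb₀ v hv k
  have heq : star (steering τ β u k) * response τ β w u - star (steering τ β v k) * response τ β w v
      = (star (steering τ β u k) - star (steering τ β v k)) * response τ β w u
        + star (steering τ β v k) * (response τ β w u - response τ β w v) := by ring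
  rw [heq]
  refine (norm_add_le _ _).trans ?_
  rw [norm_mul, norm_mul]
  have h5 := mul_le_mul h1 h2 (norm_nonneg _) (by positivity)
  have h6 := mul_le_mul h4 h3 (norm_nonneg _) hC₀.le
  have h7 : 0 ≤ |u - v| * ‖w‖ := by positivity
  calc _ ≤ _ := add_le_add h5 h6
    _ = 2 * d * C₀ * C₁ * |u - v| * ‖w‖ := by rw [← hd]; ring
    _ ≤ _ := by linarith

lemma powerInfo_eq_of_eq_off_pair (τ : Fin L → ℝ) (β : Fin L → ℂ) {N : ℕ} {n m : Fin N}
    (hnm : n ≠ m) (p : Fin N → ℝ) (hp : ∀ k, k ≠ n → k ≠ m → p k = 0) :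
    powerInfo τ β p = p n • toneInfo τ β ((n : ℕ) / N : ℝ) + p m • toneInfo τ β ((m : ℕ) / N : ℝ) := by
  rw [powerInfo, ← sum_pair (f := fun k : Fin N => p k • toneInfo τ β ((k : ℕ) / N : ℝ)) hnm]
  refine (sum_subset (subset_univ _) fun k _ hk => ?_).symm
  simp only [mem_insert, mem_singleton, not_or] at hk
  rw [hp k hk.1 hk.2, zero_smul]

lemma fin_div_mem_Icc {N : ℕ} (n : Fin N) : ((n : ℕ) / N : ℝ) ∈ Set.Icc (0 : ℝ) 1 :=
  ⟨by positivity, div_le_one_of_le₀ (by exact_mod_cast n.2.le) (by positivity)⟩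

set_option maxHeartbeats 1000000 in
/-- Changing the powers of two tones changes the curvature of the bound in the direction that moves
power between them only by a factor `1 + O(1/N)`. -/
lemma exists_curvatureForm_perturbation (τ : Fin L → ℝ) (hτ : Function.Injective τ)
    (β : Fin L → ℂ) (hβ : ∀ l, β l ≠ 0) {ρ₁ ρ₂ : ℝ} (hρ₁ : 0 < ρ₁) :
    ∃ C : ℝ, 0 < C ∧ ∃ N₀ : ℕ, 0 < N₀ ∧ ∀ N ≥ N₀, ∀ n m : Fin N, n ≠ m →
      ∀ p q r : Fin N → ℝ, (∀ k, p k ∈ Set.Icc ρ₁ ρ₂) → (∀ k, q k ∈ Set.Icc ρ₁ ρ₂) →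
      (∀ k, r k ∈ Set.Icc ρ₁ ρ₂) → (∀ k, k ≠ n → k ≠ m → p k = r k) →
      (∀ k, k ≠ n → k ≠ m → q k = r k) →
      0 ≤ curvatureForm (powerInfo τ β r)⁻¹
        ((toneInfo τ β ((n : ℕ) / N : ℝ) - toneInfo τ β ((m : ℕ) / N : ℝ)) * (powerInfo τ β r)⁻¹) ∧
      |curvatureForm (powerInfo τ β q)⁻¹
        ((toneInfo τ β ((n : ℕ) / N : ℝ) - toneInfo τ β ((m : ℕ) / N : ℝ)) * (powerInfo τ β p)⁻¹)
      - curvatureForm (powerInfo τ β r)⁻¹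
        ((toneInfo τ β ((n : ℕ) / N : ℝ) - toneInfo τ β ((m : ℕ) / N : ℝ)) * (powerInfo τ β r)⁻¹)|
      ≤ C / N * curvatureForm (powerInfo τ β r)⁻¹
        ((toneInfo τ β ((n : ℕ) / N : ℝ) - toneInfo τ β ((m : ℕ) / N : ℝ)) * (powerInfo τ β r)⁻¹) := by
  obtain ⟨c₁, hc₁, C₁, hC₁, N₀, hN₀, hJ⟩ := exists_powerInfo_bounds τ hτ β hβ (ρ₂ := ρ₂) hρ₁
  obtain ⟨C₀, hC₀, hb₀⟩ := exists_norm_steering_le τ β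
  obtain ⟨CΔ, hCΔ, hΔ⟩ := norm_toneInfo_sub_mulVec_le τ β
  set d : ℝ := (Fintype.card (Param L) : ℝ) with hd
  have hd0 : 0 ≤ d := by positivity
  set κ := d / c₁ with hκ
  have hκ0 : 0 ≤ κ := by positivity
  set γ := c₁ / C₁ ^ 2 with hγ
  have hγ0 : 0 < γ := by positivity
  -- The denominator `L + 1` rather than `L` keeps the constant meaningful for `L = 0`.
  obtain ⟨Ck, hCk, hkey⟩ := exists_abs_sub_mul_norm_response_le τ β hβ (c := γ / (L + 1)) (R := κ)
    (by positivity) hκ0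
  set ρ := |ρ₂| with hρ
  have hρ0 : 0 ≤ ρ := abs_nonneg _
  set C₃ := CΔ * κ * (ρ * C₀ * (2 * Ck)) with hC₃
  have hC₃0 : 0 ≤ C₃ := by positivity
  set C₄ := 2 * ρ * C₀ * (d * C₀) with hC₄
  have hC₄0 : 0 ≤ C₄ := by positivity
  set C₅ := d * C₃ * κ * (C₃ + 1) + d * κ * C₃ + d * κ * C₄ * κ with hC₅
  have hC₅0 : 0 ≤ C₅ := by positivity
  refine ⟨L * C₅ * L / γ + 1, by positivity, N₀, hN₀, ?_⟩
  intro N hN n m hnm p q r hp hq hr hpr hqr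
  have hNpos : 0 < N := by omega
  have hN' : (0 : ℝ) < N := by exact_mod_cast hNpos
  have hN1 : (1 : ℝ) ≤ N := by exact_mod_cast hNpos
  set u : ℝ := ((n : ℕ) / N : ℝ) with hu
  set v : ℝ := ((m : ℕ) / N : ℝ) with hv
  have huI : u ∈ Set.Icc (0 : ℝ) 1 := fin_div_mem_Icc n
  have hvI : v ∈ Set.Icc (0 : ℝ) 1 := fin_div_mem_Icc m
  set Δ := toneInfo τ β u - toneInfo τ β v with hΔd
  have hcN : 0 < c₁ * N := by positivity
  have hCN : 0 < C₁ * N := by positivity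
  have hunit : ∀ p : Fin N → ℝ, (∀ k, p k ∈ Set.Icc ρ₁ ρ₂) → IsUnit (powerInfo τ β p).det :=
    fun p hp => isUnit_det_of_coercive hcN fun w => (hJ N hN p hp w).1
  have hinv : ∀ p : Fin N → ℝ, (∀ k, p k ∈ Set.Icc ρ₁ ρ₂) → ∀ x,
      ‖(powerInfo τ β p)⁻¹ *ᵥ x‖ ≤ κ / N * ‖x‖ := fun p hp x => by
    have := norm_inv_mulVec_le hcN (fun w => (hJ N hN p hp w).1) x
    rwa [← div_div, ← hd, ← hκ] at this
  have hlow : ∀ x, γ / N * ‖x‖ ^ 2 ≤ x ⬝ᵥ ((powerInfo τ β r)⁻¹ *ᵥ x) := fun x => by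
    have := le_dotProduct_inv_mulVec hcN hCN (fun w => (hJ N hN r hr w).1)
      (fun w => (hJ N hN r hr w).2) x
    have e : c₁ * N / (C₁ * N) ^ 2 = γ / N := by rw [hγ]; field_simp
    rwa [e] at this
  set B₀ := (powerInfo τ β r)⁻¹ with hB₀
  set B := (powerInfo τ β p)⁻¹ with hB
  set W := (powerInfo τ β q)⁻¹ with hW
  have hB₀t : B₀ᵀ = B₀ := inv_transpose_of_symm (powerInfo_transpose _ _ _)
  -- differences of information matrices
  have hdiff : ∀ p : Fin N → ℝ, (∀ k, p k ∈ Set.Icc ρ₁ ρ₂) → (∀ k, k ≠ n → k ≠ m → p k = r k) →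
      ∀ x, ‖(powerInfo τ β p - powerInfo τ β r) *ᵥ x‖ ≤
        ρ * C₀ * (‖response τ β x u‖ + ‖response τ β x v‖) := by
    intro p hp hpr x
    have habs : ∀ k, |(p - r) k| ≤ ρ := by
      intro k
      have h1 := hp k
      have h2 := hr k
      have h3 := le_abs_self ρ₂
      rw [Pi.sub_apply, abs_le]
      constructor <;> linarith [h1.1, h1.2, h2.1, h2.2]
    rw [powerInfo_sub, powerInfo_eq_of_eq_off_pair τ β hnm (p - r)
      (fun k h1 h2 => by rw [Pi.sub_apply, hpr k h1 h2, sub_self]), Matrix.add_mulVec,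
      Matrix.smul_mulVec, Matrix.smul_mulVec]
    refine (norm_add_le _ _).trans ?_
    rw [norm_smul, norm_smul]
    have h1 := mul_le_mul (habs n) (norm_toneInfo_mulVec_le τ β hC₀.le (hb₀ u huI) x)
      (norm_nonneg _) hρ0
    have h2 := mul_le_mul (habs m) (norm_toneInfo_mulVec_le τ β hC₀.le (hb₀ v hvI) x)
      (norm_nonneg _) hρ0
    rw [Real.norm_eq_abs, Real.norm_eq_abs]
    linarith
  let e : Fin L → Param L → ℝ := fun l => Pi.single (Sum.inl l) 1
  have he : ∀ l, ‖e l‖ ≤ 1 := fun l => by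
    refine (pi_norm_le_iff_of_nonneg zero_le_one).2 fun k => ?_
    by_cases h : k = Sum.inl l
    · subst h; simp [e]
    · simp [e, h]
  set y₀ : Fin L → Param L → ℝ := fun l => (Δ * B₀) *ᵥ e l with hy₀
  set y : Fin L → Param L → ℝ := fun l => (Δ * B) *ᵥ e l with hy
  -- All errors are measured against `Y`, the size of `Δ * B₀` on the delay directions, because `Y²`
  -- is comparable to `N` times the reference curvature. An absolute bound would be useless when `u`
  -- and `v` are close.
  set Y := ∑ l, ‖y₀ l‖ with hY
  have hY0 : 0 ≤ Y := sum_nonneg fun _ _ => norm_nonneg _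
  have hyY : ∀ l, ‖y₀ l‖ ≤ Y := fun l =>
    single_le_sum (f := fun l => ‖y₀ l‖) (fun _ _ => norm_nonneg _) (mem_univ l)
  -- the responses are controlled
  let V : Fin L → Param L → ℝ := fun l => (N : ℝ) • (B₀ *ᵥ e l)
  have hV : ∀ l, ‖V l‖ ≤ κ := by
    intro l
    have h1 := (hinv r hr (e l)).trans (mul_le_of_le_one_right (by positivity) (he l))
    rw [norm_smul, Real.norm_eq_abs, abs_of_pos hN']
    calc _ ≤ (N : ℝ) * (κ / N) := by gcongr
      _ = κ := by field_simp
  -- Up to the factor `N`, the delay block of `V` is that of `B₀`, a principal block of a positive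
  -- definite matrix. The scaling by `N` makes the bounds on `V` independent of `N`.
  have hcoer : ∀ z : Fin L → ℝ, γ / (L + 1) * ‖z‖ ≤ ‖fun l => ∑ j, V l (Sum.inl j) * z j‖ := by
    intro z
    set g : Fin L → ℝ := fun l => ∑ j, V l (Sum.inl j) * z j with hg
    let x : Param L → ℝ := Sum.elim z 0
    have hx : ‖z‖ ≤ ‖x‖ := (pi_norm_le_iff_of_nonneg (norm_nonneg _)).2 fun l =>
      norm_le_pi_norm x (Sum.inl l)
    have hgx : (N : ℝ) * (x ⬝ᵥ (B₀ *ᵥ x)) = z ⬝ᵥ g := by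
      have hB0g : ∀ l, g l = N * (B₀ *ᵥ x) (Sum.inl l) := by
        intro l
        rw [Matrix.mulVec, dotProduct, Fintype.sum_sum_type]
        simp only [x, Sum.elim_inl, Sum.elim_inr, Pi.zero_apply, mul_zero, sum_const_zero, add_zero]
        rw [hg, mul_sum]
        refine sum_congr rfl fun j _ => ?_
        have : V l (Sum.inl j) = N * B₀ (Sum.inl l) (Sum.inl j) := by
          simp only [V, e, Pi.smul_apply, smul_eq_mul, Matrix.mulVec_single_one, Matrix.col_apply]
          congr 1
          exact congrFun (congrFun hB₀t (Sum.inl l)) (Sum.inl j)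
        rw [this, mul_assoc]
      rw [dotProduct, dotProduct, Fintype.sum_sum_type]
      simp only [x, Sum.elim_inl, Sum.elim_inr, Pi.zero_apply, zero_mul, sum_const_zero, add_zero]
      rw [mul_sum]
      refine sum_congr rfl fun l _ => ?_
      rw [hB0g]
      ring
    have h1 : γ * ‖z‖ ^ 2 ≤ L * ‖z‖ * ‖g‖ := by
      have h2 := abs_dotProduct_le_card_mul z g
      rw [Fintype.card_fin, ← hgx] at h2
      have h3 := mul_le_mul_of_nonneg_left (hlow x) hN'.le
      calc γ * ‖z‖ ^ 2 ≤ γ * ‖x‖ ^ 2 := by gcongr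
        _ = N * (γ / N * ‖x‖ ^ 2) := by field_simp
        _ ≤ _ := h3.trans ((le_abs_self _).trans h2)
    rcases (norm_nonneg z).eq_or_lt with h0 | h0
    · rw [← h0, mul_zero]; exact norm_nonneg _
    · have h4 : γ * ‖z‖ ≤ L * ‖g‖ := by
        refine le_of_mul_le_mul_left ?_ h0
        calc _ = γ * ‖z‖ ^ 2 := by ring
          _ ≤ _ := h1
          _ = _ := by ring
      rw [div_mul_eq_mul_div, div_le_iff₀ (by positivity)]
      linarith [norm_nonneg g]
  have hε : ∀ l, ‖toneInfo τ β u *ᵥ V l - toneInfo τ β v *ᵥ V l‖ ≤ N * Y := by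
    intro l
    have h1 : toneInfo τ β u *ᵥ V l - toneInfo τ β v *ᵥ V l = (N : ℝ) • y₀ l := by
      rw [← Matrix.sub_mulVec, ← hΔd, Matrix.mulVec_smul, Matrix.mulVec_mulVec]
    rw [h1, norm_smul, Real.norm_eq_abs, abs_of_pos hN']
    gcongr
    exact hyY l
  have hresp : ∀ w ∈ Set.Icc (0 : ℝ) 1, ∀ l, ‖response τ β (V l) w‖ =
      N * ‖response τ β (B₀ *ᵥ e l) w‖ := fun w _ l => by
    rw [response_smul, norm_mul, Complex.norm_real, Real.norm_eq_abs, abs_of_pos hN']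
  have hru : ∀ l, |u - v| * ‖response τ β (B₀ *ᵥ e l) u‖ ≤ Ck * Y := by
    intro l
    have h1 := hkey u huI v hvI V hV hcoer (N * Y) hε l
    rw [hresp u huI] at h1
    refine le_of_mul_le_mul_left ?_ hN'
    linarith
  have hrv : ∀ l, |u - v| * ‖response τ β (B₀ *ᵥ e l) v‖ ≤ Ck * Y := by
    intro l
    have h1 := hkey v hvI u huI V hV hcoer (N * Y)
      (fun l => by rw [norm_sub_rev]; exact hε l) l
    rw [hresp v hvI, abs_sub_comm] at h1
    refine le_of_mul_le_mul_left ?_ hN'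
    linarith
  -- By the resolvent identity the change of `B` passes through the responses at `u` and `v`. The
  -- operator `Δ` supplies the factor `|u - v|`, and the separation estimate `hru`, `hrv` converts
  -- the product into `Y`; the factor `1 / N` comes from `B`.
  have hyy : ∀ l, ‖y l - y₀ l‖ ≤ C₃ / N * Y := by
    intro l
    have h1 : y l - y₀ l = -(Δ *ᵥ (B *ᵥ ((powerInfo τ β p - powerInfo τ β r) *ᵥ (B₀ *ᵥ e l)))) := by
      simp only [hy, hy₀]
      rw [← Matrix.sub_mulVec, ← mul_sub, inv_sub_inv_eq (hunit p hp) (hunit r hr)]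
      simp only [Matrix.mulVec_mulVec, mul_neg, Matrix.neg_mulVec, mul_assoc, hB, hB₀]
    rw [h1, norm_neg]
    set x := (powerInfo τ β p - powerInfo τ β r) *ᵥ (B₀ *ᵥ e l) with hx
    have h2 := hΔ u huI v hvI (B *ᵥ x)
    have h3 := hinv p hp x
    have h4 := hdiff p hp hpr (B₀ *ᵥ e l)
    calc ‖Δ *ᵥ (B *ᵥ x)‖ ≤ CΔ * |u - v| * ‖B *ᵥ x‖ := h2
      _ ≤ CΔ * |u - v| * (κ / N * (ρ * C₀ * (‖response τ β (B₀ *ᵥ e l) u‖ +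
            ‖response τ β (B₀ *ᵥ e l) v‖))) := by
          gcongr
          exact h3.trans (by gcongr)
      _ = CΔ * (κ / N) * (ρ * C₀) * (|u - v| * ‖response τ β (B₀ *ᵥ e l) u‖ +
            |u - v| * ‖response τ β (B₀ *ᵥ e l) v‖) := by ring
      _ ≤ CΔ * (κ / N) * (ρ * C₀) * (Ck * Y + Ck * Y) := by
          exact mul_le_mul_of_nonneg_left (add_le_add (hru l) (hrv l)) (by positivity)
      _ = _ := by rw [hC₃]; ring
  have hyn : ∀ l, ‖y l‖ ≤ (C₃ + 1) * Y := by
    intro l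
    have h1 : ‖y l‖ ≤ ‖y l - y₀ l‖ + ‖y₀ l‖ := by
      have := norm_add_le (y l - y₀ l) (y₀ l)
      rwa [sub_add_cancel] at this
    have h2 : C₃ / N ≤ C₃ := div_le_self hC₃0 hN1
    have h3 := mul_le_mul_of_nonneg_right h2 hY0
    linarith [hyy l, hyY l]
  have hquad : ∀ l, |y l ⬝ᵥ (W *ᵥ y l) - y₀ l ⬝ᵥ (B₀ *ᵥ y₀ l)| ≤ C₅ / N ^ 2 * Y ^ 2 := by
    intro l
    have h1 : y l ⬝ᵥ (W *ᵥ y l) - y₀ l ⬝ᵥ (B₀ *ᵥ y₀ l) =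
        (y l - y₀ l) ⬝ᵥ (W *ᵥ y l) + y₀ l ⬝ᵥ (W *ᵥ (y l - y₀ l)) +
          y₀ l ⬝ᵥ ((W - B₀) *ᵥ y₀ l) := by
      rw [sub_dotProduct, Matrix.mulVec_sub, dotProduct_sub, Matrix.sub_mulVec, dotProduct_sub]
      ring
    -- Here `y₀ l` already provides a factor `Y`, so no separation is needed: two inverses of size
    -- `1 / N` surround a bounded difference.
    have h2 : ‖(W - B₀) *ᵥ y₀ l‖ ≤ κ / N * (C₄ * (κ / N * Y)) := by
      rw [inv_sub_inv_eq (hunit q hq) (hunit r hr), Matrix.neg_mulVec, norm_neg, mul_assoc,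
        ← Matrix.mulVec_mulVec, ← Matrix.mulVec_mulVec]
      refine (hinv q hq _).trans ?_
      gcongr
      refine (hdiff q hq hqr _).trans ?_
      have ha := norm_response_le τ β (hb₀ u huI) (B₀ *ᵥ y₀ l)
      have hb := norm_response_le τ β (hb₀ v hvI) (B₀ *ᵥ y₀ l)
      have hc := (hinv r hr (y₀ l)).trans (mul_le_mul_of_nonneg_left (hyY l) (by positivity))
      calc ρ * C₀ * _ ≤ ρ * C₀ * (d * C₀ * (κ / N * Y) + d * C₀ * (κ / N * Y)) := by
            gcongr
            · exact ha.trans (by gcongr)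
            · exact hb.trans (by gcongr)
        _ = _ := by rw [hC₄]; ring
    have h3 := abs_dotProduct_le_card_mul (y l - y₀ l) (W *ᵥ y l)
    have h4 := abs_dotProduct_le_card_mul (y₀ l) (W *ᵥ (y l - y₀ l))
    have h5 := abs_dotProduct_le_card_mul (y₀ l) ((W - B₀) *ᵥ y₀ l)
    rw [h1]
    refine (abs_add_le _ _).trans ?_
    have h6 := abs_add_le ((y l - y₀ l) ⬝ᵥ (W *ᵥ y l)) (y₀ l ⬝ᵥ (W *ᵥ (y l - y₀ l)))
    have h7 : |(y l - y₀ l) ⬝ᵥ (W *ᵥ y l)| ≤ d * (C₃ / N * Y) * (κ / N * ((C₃ + 1) * Y)) := by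
      refine h3.trans ?_
      gcongr
      · exact hyy l
      · exact (hinv q hq _).trans (by gcongr; exact hyn l)
    have h8 : |y₀ l ⬝ᵥ (W *ᵥ (y l - y₀ l))| ≤ d * Y * (κ / N * (C₃ / N * Y)) := by
      refine h4.trans ?_
      gcongr
      · exact hyY l
      · exact (hinv q hq _).trans (by gcongr; exact hyy l)
    have h9 : |y₀ l ⬝ᵥ ((W - B₀) *ᵥ y₀ l)| ≤ d * Y * (κ / N * (C₄ * (κ / N * Y))) := by
      refine h5.trans ?_
      gcongr
      exact hyY l
    have h10 : C₅ / N ^ 2 * Y ^ 2 = d * (C₃ / N * Y) * (κ / N * ((C₃ + 1) * Y)) +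
        d * Y * (κ / N * (C₃ / N * Y)) + d * Y * (κ / N * (C₄ * (κ / N * Y))) := by
      rw [hC₅]; ring
    linarith
  -- The reference curvature is at least of order `Y² / N` and the error of order `Y² / N²`; their
  -- ratio is the claimed `O(1/N)`.
  have hG : γ / N * ∑ l, ‖y₀ l‖ ^ 2 ≤ curvatureForm B₀ (Δ * B₀) := by
    rw [curvatureForm_eq, mul_sum]
    exact sum_le_sum fun l _ => hlow (y₀ l)
  have hY2 : Y ^ 2 ≤ L * ∑ l, ‖y₀ l‖ ^ 2 := by
    have := sq_sum_le_card_mul_sum_sq (s := (univ : Finset (Fin L))) (f := fun l => ‖y₀ l‖)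
    simpa using this
  have hG0 : 0 ≤ curvatureForm B₀ (Δ * B₀) := le_trans (by positivity) hG
  refine ⟨hG0, ?_⟩
  calc |curvatureForm W (Δ * B) - curvatureForm B₀ (Δ * B₀)|
      ≤ ∑ _l : Fin L, C₅ / N ^ 2 * Y ^ 2 := by
        rw [curvatureForm_eq, curvatureForm_eq, ← sum_sub_distrib]
        exact (abs_sum_le_sum_abs _ _).trans (sum_le_sum fun l _ => hquad l)
    _ = L * (C₅ / N ^ 2) * Y ^ 2 := by
        rw [sum_const, card_univ, Fintype.card_fin, nsmul_eq_mul]; ring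
    _ ≤ L * (C₅ / N ^ 2) * (L * ∑ l, ‖y₀ l‖ ^ 2) := by gcongr
    _ = L * C₅ * L / γ / N * (γ / N * ∑ l, ‖y₀ l‖ ^ 2) := by field_simp
    _ ≤ L * C₅ * L / γ / N * curvatureForm B₀ (Δ * B₀) := by gcongr
    _ ≤ (L * C₅ * L / γ + 1) / N * curvatureForm B₀ (Δ * B₀) := by
        gcongr
        linarith

/-! ### The Fisher information in the frequency domain -/

lemma dft_mul_conjTranspose (N : ℕ) : dft N * (dft N)ᴴ = 1 := by
  ext m k
  have hN : 0 < N := m.pos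
  have hN' : (N : ℂ) ≠ 0 := by exact_mod_cast hN.ne'
  set ζ : ℂ := Complex.exp (2 * Real.pi * Complex.I * (((k : ℕ) : ℂ) - ((m : ℕ) : ℂ)) / N) with hζ
  have hs : ((1 / Real.sqrt N : ℝ) : ℂ) * ((1 / Real.sqrt N : ℝ) : ℂ) = 1 / N := by
    rw [← Complex.ofReal_mul, div_mul_div_comm, Real.mul_self_sqrt (by positivity)]
    push_cast
    ring
  have hterm : ∀ n : Fin N, dft N m n * (dft N)ᴴ n k = 1 / N * ζ ^ (n : ℕ) := by
    intro n
    simp only [dft, Matrix.conjTranspose_apply, Matrix.of_apply, star_mul, Complex.star_def,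
      Complex.conj_ofReal]
    rw [← Complex.exp_conj, mul_comm (Complex.exp (starRingEnd ℂ _)), mul_mul_mul_comm, hs, ← Complex.exp_add,
      hζ, ← Complex.exp_nat_mul]
    congr 2
    simp only [map_neg, map_div₀, map_mul, map_ofNat, Complex.conj_I, Complex.conj_ofReal,
      map_natCast]
    ring
  rw [Matrix.mul_apply, sum_congr rfl fun n _ => hterm n, ← mul_sum,
    Fin.sum_univ_eq_sum_range (fun n => ζ ^ n) N, Matrix.one_apply]
  split_ifs with h
  · subst h
    have : ζ = 1 := by rw [hζ]; simp
    rw [this]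
    simp [hN']
  · have hne : ζ ≠ 1 := by
      rw [hζ, Ne, Complex.exp_eq_one_iff]
      rintro ⟨z, hz⟩
      have hpi : (2 * Real.pi * Complex.I : ℂ) ≠ 0 := by simp [Real.pi_ne_zero]
      have h1 : (((k : ℕ) : ℂ) - ((m : ℕ) : ℂ)) = z * N := by
        field_simp at hz
        have : (2 * Real.pi * Complex.I : ℂ) * (((k : ℕ) : ℂ) - ((m : ℕ) : ℂ)) =
          (2 * Real.pi * Complex.I : ℂ) * (z * N) := by linear_combination (2 * Real.pi * Complex.I : ℂ) * hz
        exact mul_left_cancel₀ hpi this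
      have h2 : ((k : ℕ) : ℤ) - ((m : ℕ) : ℤ) = z * N := by exact_mod_cast h1
      have hk := k.2
      have hm := m.2
      have h3 : z = 0 := by
        by_contra hz0
        rcases lt_or_gt_of_ne hz0 with h4 | h4 <;> nlinarith
      rw [h3] at h2
      exact h (Fin.ext (by omega))
    have hpow : ζ ^ N = 1 := by
      rw [hζ, ← Complex.exp_nat_mul, Complex.exp_eq_one_iff]
      refine ⟨(k : ℕ) - (m : ℕ), ?_⟩
      push_cast
      field_simp
    have := geom_sum_mul ζ N
    rw [hpow, sub_self] at this
    rw [(mul_eq_zero.1 this).resolve_right (sub_ne_zero.2 hne), mul_zero]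

lemma delay_mulVec (N : ℕ) (τ : ℝ) (y : Fin N → ℂ) :
    delay N τ *ᵥ ((dft N)ᴴ *ᵥ y) =
      (dft N)ᴴ *ᵥ fun n => delayPhase τ ((n : ℕ) / N : ℝ) * y n := by
  rw [delay, Matrix.mulVec_mulVec, mul_assoc, mul_assoc, dft_mul_conjTranspose, mul_one,
    ← Matrix.mulVec_mulVec]
  congr 1
  funext n
  rw [Matrix.mulVec_diagonal, delayPhase]
  congr 2
  push_cast
  ring

lemma hasLineDerivAt_meanSignal (N : ℕ) (y : Fin N → ℂ) (τ : Fin L → ℝ) (β : Fin L → ℂ)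
    (w : Param L → ℝ) :
    HasLineDerivAt ℝ (meanSignal N ((dft N)ᴴ *ᵥ y))
      ((dft N)ᴴ *ᵥ fun n => response τ β w ((n : ℕ) / N : ℝ) * y n) (paramVec τ β) w := by
  have hcoef : ∀ u : ℝ, HasDerivAt (fun t : ℝ => ∑ l : Fin L,
      (((paramVec τ β + t • w) (Sum.inr (Sum.inl l)) : ℂ)
        + Complex.I * ((paramVec τ β + t • w) (Sum.inr (Sum.inr l)) : ℂ)) *
        delayPhase ((paramVec τ β + t • w) (Sum.inl l)) u) (response τ β w u) 0 := by
    intro u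
    rw [response_eq]
    refine HasDerivAt.fun_sum fun l _ => ?_
    have hlin : ∀ k : Param L, HasDerivAt (fun t : ℝ => (paramVec τ β + t • w) k) (w k) 0 := by
      intro k
      have := ((hasDerivAt_id (0 : ℝ)).mul_const (w k)).const_add (paramVec τ β k)
      simpa using this
    have hdp : HasDerivAt (fun t : ℝ => delayPhase ((paramVec τ β + t • w) (Sum.inl l)) u)
        (w (Sum.inl l) • (-(2 * Real.pi * Complex.I * u) * delayPhase (τ l) u)) 0 := by
      -- Delay and frequency enter the phase symmetrically, so the derivative in `u` also serves as
      -- the derivative in `τ`.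
      have hsymm : ∀ a b : ℝ, delayPhase a b = delayPhase b a := fun a b => by
        rw [delayPhase, delayPhase]; congr 1; ring
      have h1 := hasDerivAt_delayPhase u ((paramVec τ β + (0 : ℝ) • w) (Sum.inl l))
      have h2 := h1.scomp (0 : ℝ) (hlin (Sum.inl l))
      have e : (paramVec τ β + (0 : ℝ) • w) (Sum.inl l) = τ l := by simp [paramVec]
      rw [e, hsymm u (τ l)] at h2
      refine h2.congr_of_eventuallyEq (Filter.Eventually.of_forall fun t => ?_)
      exact hsymm _ _
    have h3 := ((hlin (Sum.inr (Sum.inl l))).ofReal_comp).add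
      (((hlin (Sum.inr (Sum.inr l))).ofReal_comp).const_mul Complex.I)
    refine (h3.mul hdp).congr_deriv ?_
    have e : ((paramVec τ β + (0 : ℝ) • w) (Sum.inr (Sum.inl l)) : ℂ)
        + Complex.I * ((paramVec τ β + (0 : ℝ) • w) (Sum.inr (Sum.inr l)) : ℂ) = β l := by
      simp only [zero_smul, add_zero, paramVec, Sum.elim_inr, Sum.elim_inl]
      rw [mul_comm, Complex.re_add_im]
    have e' : (paramVec τ β + (0 : ℝ) • w) (Sum.inl l) = τ l := by simp [paramVec]
    simp only [Pi.add_apply] at e e' ⊢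
    rw [e', e, Complex.real_smul]
    ring
  have hmean : ∀ θ : Param L → ℝ, meanSignal N ((dft N)ᴴ *ᵥ y) θ = (dft N)ᴴ *ᵥ fun n =>
      (∑ l : Fin L, ((θ (Sum.inr (Sum.inl l)) : ℂ) + Complex.I * (θ (Sum.inr (Sum.inr l)) : ℂ)) *
        delayPhase (θ (Sum.inl l)) ((n : ℕ) / N : ℝ)) * y n := by
    intro θ
    simp only [meanSignal, delay_mulVec, ← Matrix.mulVec_smul]
    rw [← Matrix.mulVec_sum]
    congr 1
    funext n
    rw [Finset.sum_apply, sum_mul]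
    refine sum_congr rfl fun l _ => ?_
    rw [Pi.smul_apply, smul_eq_mul, mul_assoc]
  rw [HasLineDerivAt]
  simp only [hmean]
  refine hasDerivAt_pi.2 fun i => ?_
  exact HasDerivAt.fun_sum (u := (univ : Finset (Fin N))) fun n _ =>
    ((hcoef ((n : ℕ) / N : ℝ)).mul_const (y n)).const_mul ((dft N)ᴴ i n)

lemma response_single (τ : Fin L → ℝ) (β : Fin L → ℂ) (k : Param L) (u : ℝ) :
    response τ β (Pi.single k 1) u = steering τ β u k := by
  rw [response, sum_eq_single k]
  · simp
  · intro j _ hj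
    simp [hj]
  · simp

/-- The unitary DFT drops out of the inner products of the gradients, leaving a sum over tones in
which the signal enters through its power spectrum alone. -/
lemma fim_eq (N : ℕ) (σ : ℝ) (y : Fin N → ℂ) (τ : Fin L → ℝ) (β : Fin L → ℂ) :
    fim N σ ((dft N)ᴴ *ᵥ y) (paramVec τ β) =
      (2 / σ ^ 2) • powerInfo τ β (fun n => ‖y n‖ ^ 2) := by
  ext k l
  rw [fim, Matrix.of_apply, (hasLineDerivAt_meanSignal N y τ β _).lineDeriv,
    (hasLineDerivAt_meanSignal N y τ β _).lineDeriv, Matrix.smul_apply, smul_eq_mul,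
    Matrix.star_mulVec, Matrix.conjTranspose_conjTranspose, ← Matrix.dotProduct_mulVec,
    Matrix.mulVec_mulVec, dft_mul_conjTranspose, Matrix.one_mulVec, powerInfo, Matrix.sum_apply,
    dotProduct, Complex.re_sum]
  congr 1
  refine sum_congr rfl fun n _ => ?_
  rw [Matrix.smul_apply, smul_eq_mul, toneInfo, Matrix.of_apply, ← Complex.re_ofReal_mul]
  have h : ((‖y n‖ ^ 2 : ℝ) : ℂ) = star (y n) * y n := by
    rw [← Complex.normSq_eq_norm_sq, Complex.star_def, Complex.normSq_eq_conj_mul_self]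
  rw [h, Pi.star_apply, response_single, response_single, star_mul]
  congr 1
  ring

/-- For singular `M` both sides vanish, since the inverse of a singular matrix is `0` by convention.
The formula for the bound thus needs no invertibility. -/
lemma inv_smul_matrix {ι : Type*} [Fintype ι] [DecidableEq ι] {a : ℝ} (ha : a ≠ 0)
    (M : Matrix ι ι ℝ) : (a • M)⁻¹ = a⁻¹ • M⁻¹ := by
  by_cases h : IsUnit M.det
  · exact Matrix.inv_smul' M (Units.mk0 a ha) h
  · have h' : ¬ IsUnit (a • M).det := by
      rw [Matrix.det_smul, isUnit_iff_ne_zero, not_not]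
      rw [isUnit_iff_ne_zero, not_not] at h
      rw [h, mul_zero]
    rw [Matrix.nonsing_inv_apply_not_isUnit _ h, Matrix.nonsing_inv_apply_not_isUnit _ h', smul_zero]

lemma trace_selectDelays_mul (X : Matrix (Param L) (Param L) ℝ) :
    ((selectDelays L)ᵀ * selectDelays L * X).trace = delayTrace X := by
  rw [Matrix.mul_assoc, Matrix.trace_mul_comm, Matrix.trace, delayTrace]
  refine sum_congr rfl fun l _ => ?_
  simp [selectDelays, Matrix.mul_apply, Fintype.sum_sum_type, Matrix.one_apply]

lemma conditionalCRB_eq (N : ℕ) {σ : ℝ} (hσ : 0 < σ) (τ : Fin L → ℝ) (β : Fin L → ℂ)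
    (V : Matrix (Fin N) (Fin N) ℂ) (s : Fin N → ℂ) :
    conditionalCRB N σ τ β ((dft N)ᴴ * V) s =
      σ ^ 2 / 2 * delayTrace (powerInfo τ β fun n => ‖(V *ᵥ s) n‖ ^ 2)⁻¹ := by
  rw [conditionalCRB, trace_selectDelays_mul, ← Matrix.mulVec_mulVec, fim_eq,
    inv_smul_matrix (by positivity), delayTrace, delayTrace, mul_sum]
  refine sum_congr rfl fun l _ => ?_
  rw [Matrix.smul_apply, smul_eq_mul, inv_div]

/-! ### Derivatives along the geodesics -/

open scoped Matrix.Norms.Operator in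
lemma hasDerivAt_exp_smul_mulVec {N : ℕ} (K : Matrix (Fin N) (Fin N) ℂ) (s : Fin N → ℂ) (t : ℝ)
    (n : Fin N) : HasDerivAt (fun t : ℝ => (NormedSpace.exp (t • K) *ᵥ s) n)
      ((NormedSpace.exp (t • K) *ᵥ (K *ᵥ s)) n) t := by
  have h := hasDerivAt_exp_smul_const (𝕂 := ℝ) K t
  let T : Matrix (Fin N) (Fin N) ℂ →ₗ[ℝ] ℂ :=
    { toFun := fun M => (M *ᵥ s) n
      map_add' := fun A B => by rw [Matrix.add_mulVec, Pi.add_apply]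
      map_smul' := fun r A => by rw [Matrix.smul_mulVec, Pi.smul_apply, RingHom.id_apply] }
  have h2 := (LinearMap.toContinuousLinearMap T).hasFDerivAt.comp_hasDerivAt t h
  rw [Matrix.mulVec_mulVec]
  exact h2

/-- Differentiation in `t` replaces `s` by `K *ᵥ s`, hence the induction over all `s` at once. -/
lemma contDiff_exp_smul_mulVec {N : ℕ} (K : Matrix (Fin N) (Fin N) ℂ) (k : ℕ) (s : Fin N → ℂ)
    (n : Fin N) : ContDiff ℝ k (fun t : ℝ => (NormedSpace.exp (t • K) *ᵥ s) n) := by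
  induction k generalizing s with
  | zero =>
    exact contDiff_zero.2 (continuous_iff_continuousAt.2 fun t =>
      (hasDerivAt_exp_smul_mulVec K s t n).continuousAt)
  | succ k ih =>
    rw [Nat.cast_add, Nat.cast_one, contDiff_succ_iff_deriv]
    refine ⟨fun t => (hasDerivAt_exp_smul_mulVec K s t n).differentiableAt, by simp, ?_⟩
    rw [funext fun t => (hasDerivAt_exp_smul_mulVec K s t n).deriv]
    exact ih (K *ᵥ s)

lemma hasDerivAt_re_star_mul {a b : ℝ → ℂ} {a' b' : ℂ} {t : ℝ} (ha : HasDerivAt a a' t)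
    (hb : HasDerivAt b b' t) : HasDerivAt (fun t => (star (a t) * b t).re)
      ((star a' * b t).re + (star (a t) * b').re) t := by
  have h := (Complex.reCLM.hasFDerivAt).comp_hasDerivAt t (ha.star.mul hb)
  rw [Complex.reCLM_apply, Complex.add_re] at h
  exact h

lemma norm_sq_eq_re (z : ℂ) : ‖z‖ ^ 2 = (star z * z).re := by
  rw [← Complex.normSq_eq_norm_sq, Complex.star_def, ← Complex.normSq_eq_conj_mul_self,
    Complex.ofReal_re]

section Inverse

open scoped Matrix.Norms.Operator

variable {ι : Type*} [Fintype ι] [DecidableEq ι]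

lemma hasDerivAt_matrix_inv {M : ℝ → Matrix ι ι ℝ} {M' : Matrix ι ι ℝ} {t : ℝ}
    (hM : HasDerivAt M M' t) (h : IsUnit (M t).det) :
    HasDerivAt (fun t => (M t)⁻¹) (-((M t)⁻¹ * M' * (M t)⁻¹)) t := by
  obtain ⟨U, hU⟩ := (Matrix.isUnit_iff_isUnit_det _).2 h
  have h1 := hasFDerivAt_ringInverse (𝕜 := ℝ) U
  rw [hU] at h1
  have h2 := h1.comp_hasDerivAt t hM
  have h3 : (↑U⁻¹ : Matrix ι ι ℝ) = (M t)⁻¹ := by rw [← hU, Matrix.coe_units_inv]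
  have h4 : (fun t => (M t)⁻¹) = Ring.inverse ∘ M := by
    funext t
    rw [Function.comp_apply, Matrix.nonsing_inv_eq_ringInverse]
  rw [h4, ← h3]
  exact h2

lemma contDiffAt_matrix_inv {M : ℝ → Matrix ι ι ℝ} {t : ℝ} {k : WithTop ℕ∞}
    (hM : ContDiffAt ℝ k M t) (h : IsUnit (M t).det) : ContDiffAt ℝ k (fun t => (M t)⁻¹) t := by
  obtain ⟨U, hU⟩ := (Matrix.isUnit_iff_isUnit_det _).2 h
  have h1 := contDiffAt_ringInverse (n := k) ℝ U
  rw [hU] at h1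
  have h4 : (fun t => (M t)⁻¹) = Ring.inverse ∘ M := by
    funext t
    rw [Function.comp_apply, Matrix.nonsing_inv_eq_ringInverse]
  rw [h4]
  exact h1.comp t hM

/-- The partial trace over the delays as a continuous linear map. -/
def delayTraceCLM (L : ℕ) : Matrix (Param L) (Param L) ℝ →L[ℝ] ℝ :=
  LinearMap.toContinuousLinearMap
    { toFun := delayTrace
      map_add' := fun A B => by simp [delayTrace, sum_add_distrib]
      map_smul' := fun r A => by simp [delayTrace, mul_sum] }

lemma delayTraceCLM_apply (X : Matrix (Param L) (Param L) ℝ) :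
    delayTraceCLM L X = delayTrace X := rfl

lemma iteratedDeriv_two_delayTrace_inv {M M₁ : ℝ → Matrix (Param L) (Param L) ℝ}
    {M₂ : Matrix (Param L) (Param L) ℝ} (hM : ∀ t, HasDerivAt M (M₁ t) t)
    (hM₁ : HasDerivAt M₁ M₂ 0) (h : IsUnit (M 0).det) :
    iteratedDeriv 2 (fun t => delayTrace (M t)⁻¹) 0 =
      2 * delayTrace ((M 0)⁻¹ * M₁ 0 * (M 0)⁻¹ * M₁ 0 * (M 0)⁻¹)
        - delayTrace ((M 0)⁻¹ * M₂ * (M 0)⁻¹) := by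
  have hcont : Continuous M := continuous_iff_continuousAt.2 fun t => (hM t).continuousAt
  have hev : ∀ᶠ t in 𝓝 (0 : ℝ), IsUnit (M t).det := by
    have h1 : ContinuousAt (fun t => (M t).det) 0 := hcont.matrix_det.continuousAt
    filter_upwards [h1.eventually_ne h.ne_zero] with t ht using isUnit_iff_ne_zero.2 ht
  have hd1 : deriv (fun t => delayTrace (M t)⁻¹) =ᶠ[𝓝 0]
      fun t => delayTraceCLM L (-((M t)⁻¹ * M₁ t * (M t)⁻¹)) := by
    filter_upwards [hev] with t ht
    exact ((delayTraceCLM L).hasFDerivAt.comp_hasDerivAt t (hasDerivAt_matrix_inv (hM t) ht)).deriv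
  have hB := hasDerivAt_matrix_inv (hM 0) h
  have hd2 := (delayTraceCLM L).hasFDerivAt.comp_hasDerivAt (0 : ℝ) ((hB.mul hM₁).mul hB).neg
  rw [iteratedDeriv_succ, iteratedDeriv_one, hd1.deriv_eq]
  refine hd2.deriv.trans ?_
  have h5 : -((-((M 0)⁻¹ * M₁ 0 * (M 0)⁻¹) * M₁ 0 + (M 0)⁻¹ * M₂) * (M 0)⁻¹ +
      (M 0)⁻¹ * M₁ 0 * -((M 0)⁻¹ * M₁ 0 * (M 0)⁻¹)) =
      (2 : ℝ) • ((M 0)⁻¹ * M₁ 0 * (M 0)⁻¹ * M₁ 0 * (M 0)⁻¹) - (M 0)⁻¹ * M₂ * (M 0)⁻¹ := by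
    rw [two_smul]; noncomm_ring
  have h6 := congrArg (delayTraceCLM L) h5
  rw [map_sub, map_smul, smul_eq_mul, delayTraceCLM_apply, delayTraceCLM_apply,
    delayTraceCLM_apply] at h6
  exact h6

lemma hasDerivAt_powerInfo (τ : Fin L → ℝ) (β : Fin L → ℂ) {N : ℕ} {p : ℝ → Fin N → ℝ}
    {p' : Fin N → ℝ} {t : ℝ} (hp : ∀ n, HasDerivAt (fun t => p t n) (p' n) t) :
    HasDerivAt (fun t => powerInfo τ β (p t)) (powerInfo τ β p') t :=
  HasDerivAt.fun_sum fun n _ => (hp n).smul_const _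

lemma contDiff_powerInfo (τ : Fin L → ℝ) (β : Fin L → ℂ) {N : ℕ} {p : ℝ → Fin N → ℝ}
    {k : WithTop ℕ∞} (hp : ∀ n, ContDiff ℝ k (fun t => p t n)) :
    ContDiff ℝ k (fun t => powerInfo τ β (p t)) :=
  ContDiff.sum fun n _ => (hp n).smul contDiff_const

end Inverse

section Geodesic

open scoped Matrix.Norms.Operator

variable (τ : Fin L → ℝ) (β : Fin L → ℂ) {N : ℕ} (K : Matrix (Fin N) (Fin N) ℂ) (s : Fin N → ℂ)

/-- The powers of the tones along a geodesic. -/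
def tonePower (t : ℝ) (n : Fin N) : ℝ := ‖(NormedSpace.exp (t • K) *ᵥ s) n‖ ^ 2

/-- The first derivative of the powers of the tones at OFDM. -/
def tonePowerDeriv (n : Fin N) : ℝ := 2 * (star (s n) * (K *ᵥ s) n).re

/-- The second derivative of the powers of the tones at OFDM. -/
def tonePowerDeriv₂ (n : Fin N) : ℝ :=
  2 * ‖(K *ᵥ s) n‖ ^ 2 + 2 * (star (s n) * (K *ᵥ (K *ᵥ s)) n).re

lemma tonePower_zero : tonePower K s 0 = fun n => ‖s n‖ ^ 2 := by
  funext n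
  rw [tonePower, zero_smul, NormedSpace.exp_zero, Matrix.one_mulVec]

lemma contDiff_tonePower (k : ℕ) (n : Fin N) : ContDiff ℝ k (fun t => tonePower K s t n) :=
  (contDiff_exp_smul_mulVec K k s n).norm_sq ℝ

lemma contDiffAt_delayTrace_inv (h : IsUnit (powerInfo τ β fun n => ‖s n‖ ^ 2).det) :
    ContDiffAt ℝ 2 (fun t => delayTrace (powerInfo τ β (tonePower K s t))⁻¹) 0 := by
  have h1 := contDiff_powerInfo τ β (contDiff_tonePower K s 2)
  rw [← tonePower_zero K s] at h
  exact (delayTraceCLM L).contDiff.contDiffAt.comp (0 : ℝ)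
    (contDiffAt_matrix_inv h1.contDiffAt h)

lemma iteratedDeriv_two_delayTrace_powerInfo_inv
    (h : IsUnit (powerInfo τ β fun n => ‖s n‖ ^ 2).det) :
    iteratedDeriv 2 (fun t => delayTrace (powerInfo τ β (tonePower K s t))⁻¹) 0 =
      2 * delayTrace ((powerInfo τ β fun n => ‖s n‖ ^ 2)⁻¹ * powerInfo τ β (tonePowerDeriv K s) *
        (powerInfo τ β fun n => ‖s n‖ ^ 2)⁻¹ * powerInfo τ β (tonePowerDeriv K s) *
        (powerInfo τ β fun n => ‖s n‖ ^ 2)⁻¹)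
      - delayTrace ((powerInfo τ β fun n => ‖s n‖ ^ 2)⁻¹ * powerInfo τ β (tonePowerDeriv₂ K s) *
        (powerInfo τ β fun n => ‖s n‖ ^ 2)⁻¹) := by
  set y : (Fin N → ℂ) → ℝ → Fin N → ℂ := fun s t => NormedSpace.exp (t • K) *ᵥ s with hy
  have hyd : ∀ s t n, HasDerivAt (fun t => y s t n) (y (K *ᵥ s) t n) t := fun s t n =>
    hasDerivAt_exp_smul_mulVec K s t n
  have hy0 : ∀ s, y s 0 = s := fun s => by
    simp only [hy]; rw [zero_smul, NormedSpace.exp_zero, Matrix.one_mulVec]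
  have hcomm : ∀ a b : ℂ, (star a * b).re = (star b * a).re := fun a b => by
    simp only [Complex.mul_re, Complex.star_def, Complex.conj_re, Complex.conj_im]; ring
  set p₁ : ℝ → Fin N → ℝ := fun t n => 2 * (star (y s t n) * y (K *ᵥ s) t n).re with hp₁
  have hd1 : ∀ t n, HasDerivAt (fun t => tonePower K s t n) (p₁ t n) t := by
    intro t n
    have h1 := hasDerivAt_re_star_mul (hyd s t n) (hyd s t n)
    have h2 : (fun t => tonePower K s t n) = fun t => (star (y s t n) * y s t n).re := by
      funext t; rw [tonePower, norm_sq_eq_re]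
    rw [h2]
    refine h1.congr_deriv ?_
    rw [hcomm (y (K *ᵥ s) t n)]
    simp only [hp₁]
    ring
  have hd2 : ∀ n, HasDerivAt (fun t => p₁ t n) (tonePowerDeriv₂ K s n) 0 := by
    intro n
    refine ((hasDerivAt_re_star_mul (hyd s 0 n) (hyd (K *ᵥ s) 0 n)).const_mul 2).congr_deriv ?_
    rw [hy0, hy0, hy0, tonePowerDeriv₂, norm_sq_eq_re]
    ring
  have hp0 : p₁ 0 = tonePowerDeriv K s := by
    funext n
    simp only [hp₁]
    rw [hy0, hy0, tonePowerDeriv]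
  rw [← tonePower_zero K s] at h
  have := iteratedDeriv_two_delayTrace_inv (fun t => hasDerivAt_powerInfo τ β (hd1 t))
    (hasDerivAt_powerInfo τ β hd2) h
  rw [this, hp0, tonePower_zero]

end Geodesic

/-! ### Averages over symbol blocks -/

section Blocks

variable {S : Finset ℂ} {N : ℕ}

lemma mem_blocks {s : Fin N → ℂ} : s ∈ blocks S N ↔ ∀ n, s n ∈ S := by
  rw [blocks, Fintype.mem_piFinset]

lemma update_mem_blocks {s : Fin N → ℂ} (hs : s ∈ blocks S N) (k : Fin N) {a : ℂ} (ha : a ∈ S) :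
    Function.update s k a ∈ blocks S N := by
  rw [mem_blocks] at hs ⊢
  intro n
  by_cases h : n = k
  · subst h; rwa [Function.update_self]
  · rw [Function.update_of_ne h]; exact hs n

/-- Flipping the sign of one symbol is an involution of the set of blocks. -/
lemma sum_blocks_eq_zero_of_odd (hneg : ∀ a ∈ S, -a ∈ S) (k : Fin N) {F : (Fin N → ℂ) → ℝ}
    (hF : ∀ s, F (Function.update s k (-s k)) = -F s) : ∑ s ∈ blocks S N, F s = 0 := by
  have hmem : ∀ s ∈ blocks S N, Function.update s k (-s k) ∈ blocks S N := fun s hs =>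
    update_mem_blocks hs k (hneg _ (mem_blocks.1 hs k))
  have hinv : ∀ s : Fin N → ℂ, Function.update (Function.update s k (-s k)) k
      (-(Function.update s k (-s k)) k) = s := fun s => by simp
  have h : ∑ s ∈ blocks S N, F s = ∑ s ∈ blocks S N, -F s :=
    sum_nbij' (fun s => Function.update s k (-s k)) (fun s => Function.update s k (-s k))
      hmem hmem (fun s _ => hinv s) (fun s _ => hinv s) (fun s _ => by rw [hF, neg_neg])
  rw [sum_neg_distrib] at h
  linarith

lemma sum_blocks_comp_perm (e : Equiv.Perm (Fin N)) (F : (Fin N → ℂ) → ℝ) :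
    ∑ s ∈ blocks S N, F (s ∘ e) = ∑ s ∈ blocks S N, F s :=
  sum_nbij' (fun s => s ∘ e) (fun s => s ∘ e.symm)
    (fun s hs => mem_blocks.2 fun n => mem_blocks.1 hs (e n))
    (fun s hs => mem_blocks.2 fun n => mem_blocks.1 hs (e.symm n))
    (fun s _ => by funext n; simp) (fun s _ => by funext n; simp) (fun s _ => rfl)

/-- Resampling one symbol leaves the uniform law unchanged: swapping the entry `s k` with the new
value `a` is an involution of the pairs `(s, a)`. -/
lemma card_mul_sum_blocks (k : Fin N) (h : (Fin N → ℂ) → ℝ) :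
    (S.card : ℝ) * ∑ s ∈ blocks S N, h s =
      ∑ s ∈ blocks S N, ∑ a ∈ S, h (Function.update s k a) := by
  rw [← sum_product' (blocks S N) S (fun s a => h (Function.update s k a))]
  have h1 : ∑ x ∈ blocks S N ×ˢ S, h (Function.update x.1 k x.2) =
      ∑ x ∈ blocks S N ×ˢ S, h x.1 := by
    refine sum_nbij' (fun x => (Function.update x.1 k x.2, x.1 k))
      (fun x => (Function.update x.1 k x.2, x.1 k)) ?_ ?_ ?_ ?_ ?_
    · intro x hx
      rw [mem_product] at hx ⊢
      exact ⟨update_mem_blocks hx.1 k hx.2, mem_blocks.1 hx.1 k⟩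
    · intro x hx
      rw [mem_product] at hx ⊢
      exact ⟨update_mem_blocks hx.1 k hx.2, mem_blocks.1 hx.1 k⟩
    · intro x _; simp
    · intro x _; simp
    · intro x _; rfl
  rw [h1, sum_product, mul_sum]
  refine sum_congr rfl fun s _ => ?_
  change _ = ∑ _a ∈ S, h s
  rw [sum_const, nsmul_eq_mul]

/-- Independence: a function of the symbols `n` and `m` factors out against one that does not depend
on them. -/
lemma card_sq_mul_sum_blocks {n m : Fin N} (hnm : n ≠ m) (c : ℂ → ℂ → ℝ) {g : (Fin N → ℂ) → ℝ}
    (hn : ∀ s a, g (Function.update s n a) = g s) (hm : ∀ s a, g (Function.update s m a) = g s) :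
    (S.card : ℝ) ^ 2 * ∑ s ∈ blocks S N, c (s n) (s m) * g s =
      (∑ a ∈ S, ∑ b ∈ S, c a b) * ∑ s ∈ blocks S N, g s := by
  have h1 := card_mul_sum_blocks (S := S) n (fun s => c (s n) (s m) * g s)
  simp only [Function.update_self, Function.update_of_ne hnm.symm, hn] at h1
  rw [sq, mul_assoc, h1, sum_comm, mul_sum, sum_mul]
  refine sum_congr rfl fun a _ => ?_
  rw [card_mul_sum_blocks (S := S) m (fun s => c a (s m) * g s)]
  simp only [Function.update_self, hm]
  rw [mul_sum]
  refine sum_congr rfl fun s _ => ?_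
  rw [sum_mul]

/-! ### Diagonalization of the Hessian -/

/-- The rate of the power exchange between the tones `n` and `m` along `K`. -/
def exchange (K : Matrix (Fin N) (Fin N) ℂ) (s : Fin N → ℂ) (n m : Fin N) : ℝ :=
  2 * (star (s n) * (K n m * s m)).re

/-- Conservation of power: what the tone `n` gains from `m`, the tone `m` loses. -/
lemma exchange_antisymm {K : Matrix (Fin N) (Fin N) ℂ} (hK : Kᴴ = -K) (s : Fin N → ℂ)
    (n m : Fin N) : exchange K s m n = -exchange K s n m := by
  have h : K m n = -star (K n m) := by
    have := congrFun (congrFun hK m) n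
    rw [Matrix.conjTranspose_apply, Matrix.neg_apply] at this
    rw [this, neg_neg]
  rw [exchange, exchange, h]
  simp only [Complex.mul_re, Complex.mul_im, Complex.star_def, Complex.conj_re, Complex.conj_im,
    Complex.neg_re, Complex.neg_im]
  ring

lemma tonePowerDeriv_eq (K : Matrix (Fin N) (Fin N) ℂ) (s : Fin N → ℂ) (n : Fin N) :
    tonePowerDeriv K s n = ∑ m, exchange K s n m := by
  rw [tonePowerDeriv, Matrix.mulVec, dotProduct, mul_sum, Complex.re_sum, mul_sum]
  rfl

lemma exchange_update_left (K : Matrix (Fin N) (Fin N) ℂ) (s : Fin N → ℂ) {n m : Fin N}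
    (h : n ≠ m) : exchange K (Function.update s n (-s n)) n m = -exchange K s n m := by
  rw [exchange, exchange, Function.update_self, Function.update_of_ne h.symm, star_neg, neg_mul,
    Complex.neg_re]
  ring

lemma exchange_update_right (K : Matrix (Fin N) (Fin N) ℂ) (s : Fin N → ℂ) {n m : Fin N}
    (h : n ≠ m) : exchange K (Function.update s m (-s m)) n m = -exchange K s n m := by
  rw [exchange, exchange, Function.update_self, Function.update_of_ne h, mul_neg, mul_neg,
    Complex.neg_re]
  ring

lemma exchange_update_of_ne (K : Matrix (Fin N) (Fin N) ℂ) (s : Fin N → ℂ) {k n m : Fin N} {a : ℂ}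
    (hn : n ≠ k) (hm : m ≠ k) : exchange K (Function.update s k a) n m = exchange K s n m := by
  rw [exchange, exchange, Function.update_of_ne hn, Function.update_of_ne hm]

lemma sum_blocks_off_diagonal (hneg : ∀ a ∈ S, -a ∈ S) {a b : Fin N} (hab : a ≠ b) (c : ℂ)
    {w : (Fin N → ℂ) → ℝ} (hw : ∀ k s, w (Function.update s k (-s k)) = w s) :
    ∑ s ∈ blocks S N, (star (s a) * (c * s b)).re * w s = 0 := by
  refine sum_blocks_eq_zero_of_odd hneg a fun s => ?_
  rw [hw, Function.update_self, Function.update_of_ne hab.symm, star_neg, neg_mul, Complex.neg_re,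
    neg_mul]

lemma re_star_mul_mul_self (c z : ℂ) : (star z * (c * z)).re = c.re * ‖z‖ ^ 2 := by
  rw [norm_sq_eq_re]
  simp only [Complex.mul_re, Complex.mul_im, Complex.star_def, Complex.conj_re, Complex.conj_im]
  ring

lemma sum_blocks_row (hneg : ∀ a ∈ S, -a ∈ S) (M : Matrix (Fin N) (Fin N) ℂ) (n : Fin N)
    {w : (Fin N → ℂ) → ℝ} (hw : ∀ k s, w (Function.update s k (-s k)) = w s) :
    ∑ s ∈ blocks S N, (star (s n) * (M *ᵥ s) n).re * w s =
      ∑ s ∈ blocks S N, (M n n).re * ‖s n‖ ^ 2 * w s := by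
  have h1 : ∀ s : Fin N → ℂ, (star (s n) * (M *ᵥ s) n).re * w s =
      ∑ m, (star (s n) * (M n m * s m)).re * w s := fun s => by
    rw [Matrix.mulVec, dotProduct, mul_sum, Complex.re_sum, sum_mul]
  simp only [h1]
  rw [sum_comm, sum_eq_single n]
  · exact sum_congr rfl fun s _ => by rw [re_star_mul_mul_self]
  · intro m _ hm
    exact sum_blocks_off_diagonal hneg hm.symm _ hw
  · simp

lemma sum_blocks_norm_sq (hneg : ∀ a ∈ S, -a ∈ S) (M : Matrix (Fin N) (Fin N) ℂ) (n : Fin N)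
    {w : (Fin N → ℂ) → ℝ} (hw : ∀ k s, w (Function.update s k (-s k)) = w s) :
    ∑ s ∈ blocks S N, ‖(M *ᵥ s) n‖ ^ 2 * w s =
      ∑ s ∈ blocks S N, (∑ m, ‖M n m‖ ^ 2 * ‖s m‖ ^ 2) * w s := by
  have h1 : ∀ s : Fin N → ℂ, ‖(M *ᵥ s) n‖ ^ 2 * w s =
      ∑ a, ∑ b, (star (s a) * (star (M n a) * M n b * s b)).re * w s := fun s => by
    rw [norm_sq_eq_re, Matrix.mulVec, dotProduct, star_sum, sum_mul_sum, Complex.re_sum, sum_mul]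
    refine sum_congr rfl fun a _ => ?_
    rw [Complex.re_sum, sum_mul]
    refine sum_congr rfl fun b _ => ?_
    rw [star_mul]
    congr 2
    ring
  simp only [h1, sum_mul]
  rw [sum_comm, sum_comm (s := blocks S N)]
  refine sum_congr rfl fun a _ => ?_
  rw [sum_comm, sum_eq_single a]
  · refine sum_congr rfl fun s _ => ?_
    rw [re_star_mul_mul_self, ← norm_sq_eq_re]
  · intro b _ hb
    exact sum_blocks_off_diagonal hneg hb.symm _ hw
  · simp

lemma skew_mul_self_apply {K : Matrix (Fin N) (Fin N) ℂ} (hK : Kᴴ = -K) (n : Fin N) :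
    ((K * K) n n).re = -∑ m, ‖K n m‖ ^ 2 := by
  rw [Matrix.mul_apply, Complex.re_sum, ← sum_neg_distrib]
  refine sum_congr rfl fun m _ => ?_
  have h : K m n = -star (K n m) := by
    have := congrFun (congrFun hK m) n
    rw [Matrix.conjTranspose_apply, Matrix.neg_apply] at this
    rw [this, neg_neg]
  rw [h, mul_neg, Complex.neg_re, mul_comm, ← norm_sq_eq_re]

lemma norm_skew_symm {K : Matrix (Fin N) (Fin N) ℂ} (hK : Kᴴ = -K) (n m : Fin N) :
    ‖K m n‖ = ‖K n m‖ := by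
  have := congrFun (congrFun hK m) n
  rw [Matrix.conjTranspose_apply, Matrix.neg_apply] at this
  rw [← norm_star (K n m), this, norm_neg]

lemma delayTrace_smul (r : ℝ) (X : Matrix (Param L) (Param L) ℝ) :
    delayTrace (r • X) = r * delayTrace X := by simp [delayTrace, mul_sum]

lemma delayTrace_neg (X : Matrix (Param L) (Param L) ℝ) : delayTrace (-X) = -delayTrace X := by
  simp [delayTrace]

lemma delayTrace_sub (X Y : Matrix (Param L) (Param L) ℝ) :
    delayTrace (X - Y) = delayTrace X - delayTrace Y := by simp [delayTrace]

lemma delayTrace_sum {ι : Type*} (t : Finset ι) (X : ι → Matrix (Param L) (Param L) ℝ) :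
    delayTrace (∑ i ∈ t, X i) = ∑ i ∈ t, delayTrace (X i) := by
  simp only [delayTrace, Matrix.sum_apply]
  exact sum_comm

section Hessian

variable {K : Matrix (Fin N) (Fin N) ℂ} (A : Fin N → Matrix (Param L) (Param L) ℝ)
  {B : (Fin N → ℂ) → Matrix (Param L) (Param L) ℝ}

/-- By antisymmetry of the exchange rates, the first derivative is half the sum over ordered pairs
of rate times `A n - A m`. In its square, two different unordered pairs are uncorrelated, because
some symbol occurs in exactly one of the two rates and its sign can be flipped while `B` stays
fixed. -/
lemma sum_blocks_first_order (hneg : ∀ a ∈ S, -a ∈ S) (hK : Kᴴ = -K)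
    (hB : ∀ k s, B (Function.update s k (-s k)) = B s) :
    ∑ s ∈ blocks S N, 2 * delayTrace (B s * (∑ n, tonePowerDeriv K s n • A n) * B s *
        (∑ n, tonePowerDeriv K s n • A n) * B s) =
      ∑ n, ∑ m, ∑ s ∈ blocks S N, exchange K s n m ^ 2 *
        delayTrace (B s * (A n - A m) * B s * (A n - A m) * B s) := by
  let D : Fin N × Fin N → Matrix (Param L) (Param L) ℝ := fun x => A x.1 - A x.2
  let I : Fin N × Fin N → Fin N × Fin N → ℝ := fun x y => ∑ s ∈ blocks S N,
    exchange K s x.1 x.2 * exchange K s y.1 y.2 * delayTrace (B s * D x * B s * D y * B s)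
  have hJ : ∀ s, ∑ n, tonePowerDeriv K s n • A n =
      (1 / 2 : ℝ) • ∑ x : Fin N × Fin N, exchange K s x.1 x.2 • D x := by
    intro s
    have h1 : ∑ x : Fin N × Fin N, exchange K s x.1 x.2 • D x =
        ∑ n, ∑ m, exchange K s n m • A n - ∑ n, ∑ m, exchange K s n m • A m := by
      rw [Fintype.sum_prod_type, ← sum_sub_distrib]
      refine sum_congr rfl fun n _ => ?_
      rw [← sum_sub_distrib]
      exact sum_congr rfl fun m _ => smul_sub _ _ _
    have h2 : ∑ n, ∑ m, exchange K s n m • A m = -∑ n, ∑ m, exchange K s n m • A n := by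
      rw [sum_comm, ← sum_neg_distrib]
      refine sum_congr rfl fun n _ => ?_
      rw [← sum_neg_distrib]
      refine sum_congr rfl fun m _ => ?_
      rw [exchange_antisymm hK, neg_smul]
    rw [h1, h2, sub_neg_eq_add, ← two_smul ℝ, smul_smul]
    norm_num
    refine sum_congr rfl fun n _ => ?_
    rw [tonePowerDeriv_eq, sum_smul]
  have hexp : ∀ s, 2 * delayTrace (B s * (∑ n, tonePowerDeriv K s n • A n) * B s *
        (∑ n, tonePowerDeriv K s n • A n) * B s) = 1 / 2 * ∑ x, ∑ y,
        exchange K s x.1 x.2 * exchange K s y.1 y.2 * delayTrace (B s * D x * B s * D y * B s) := by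
    intro s
    have h1 : B s * (∑ n, tonePowerDeriv K s n • A n) * B s *
        (∑ n, tonePowerDeriv K s n • A n) * B s = (1 / 4 : ℝ) • ∑ x, ∑ y,
          (exchange K s x.1 x.2 * exchange K s y.1 y.2) • (B s * D x * B s * D y * B s) := by
      have h2 : ∀ M : Matrix (Param L) (Param L) ℝ, B s * ((1 / 2 : ℝ) • M) * B s *
          ((1 / 2 : ℝ) • M) * B s = (1 / 4 : ℝ) • (B s * M * B s * M * B s) := fun M => by
        simp only [Matrix.mul_smul, Matrix.smul_mul, smul_smul]
        norm_num
      rw [hJ s, h2]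
      congr 1
      simp only [Matrix.mul_sum, Matrix.sum_mul]
      rw [sum_comm]
      refine sum_congr rfl fun x _ => sum_congr rfl fun y _ => ?_
      simp only [Matrix.mul_smul, Matrix.smul_mul, smul_smul]
      rw [mul_comm]
    rw [h1, delayTrace_smul, delayTrace_sum]
    simp only [delayTrace_sum, delayTrace_smul]
    ring
  -- Only `(n, m)` and `(m, n)` survive against `(n, m)`. They contribute equally, as both the rate
  -- and the matrix difference change sign. This `2` cancels the `1 / 2` in `hexp`.
  have hdiag : ∀ x : Fin N × Fin N, ∑ y, I x y = 2 * I x x := by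
    rintro ⟨n, m⟩
    by_cases hnm : n = m
    · subst hnm
      have hz : ∀ y, I (n, n) y = 0 := fun y => by simp [I, D, delayTrace]
      simp [hz]
    have hswap : I (n, m) (m, n) = I (n, m) (n, m) := by
      refine sum_congr rfl fun s _ => ?_
      have hD : D (m, n) = -D (n, m) := by simp [D]
      rw [hD, mul_neg, neg_mul, exchange_antisymm hK s n m, delayTrace_neg]
      ring
    have hne : (n, m) ≠ (m, n) := fun h => hnm (Prod.ext_iff.1 h).1
    rw [← sum_subset (subset_univ {(n, m), (m, n)}), sum_pair hne, hswap, two_mul]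
    rintro ⟨a, b⟩ - hy
    simp only [mem_insert, mem_singleton, not_or, Prod.mk.injEq, not_and] at hy
    by_cases hab : a = b
    · subst hab
      simp [I, D, delayTrace]
    by_cases hn : a ≠ n ∧ b ≠ n
    · refine sum_blocks_eq_zero_of_odd hneg n fun s => ?_
      rw [hB, exchange_update_left K s hnm, exchange_update_of_ne K s hn.1 hn.2]
      ring
    -- A pair `a ≠ b` that contains `n` and differs from both orderings of `n, m` cannot contain
    -- `m`, so the sign of `s m` can be flipped instead.
    · have hm : a ≠ m ∧ b ≠ m := by
        by_contra hcon
        rw [not_and_or, not_not, not_not] at hn hcon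
        rcases hn with rfl | rfl <;> rcases hcon with rfl | rfl
        · exact hnm rfl
        · exact hy.1 rfl rfl
        · exact hy.2 rfl rfl
        · exact hnm rfl
      refine sum_blocks_eq_zero_of_odd hneg m fun s => ?_
      rw [hB, exchange_update_right K s hnm, exchange_update_of_ne K s hm.1 hm.2]
      ring
  simp only [hexp]
  rw [← mul_sum, sum_comm]
  have h3 : ∀ x : Fin N × Fin N, ∑ s ∈ blocks S N, ∑ y, exchange K s x.1 x.2 *
      exchange K s y.1 y.2 * delayTrace (B s * D x * B s * D y * B s) = 2 * I x x := fun x => by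
    rw [sum_comm]; exact hdiag x
  rw [sum_congr rfl fun x _ => h3 x, ← mul_sum, ← mul_assoc, Fintype.sum_prod_type]
  norm_num
  refine sum_congr rfl fun n _ => sum_congr rfl fun m _ => sum_congr rfl fun s _ => ?_
  rw [sq]

/-- Averaging over signs keeps the diagonal parts only: `|(K s)_n|²` becomes `∑ |K_nm|² |s_m|²`, and
the `K²` term becomes `-∑ |K_nm|² |s_n|²` by skewness. Symmetrizing over `n` and `m` produces `A n -
A m`. -/
lemma sum_blocks_second_order (hneg : ∀ a ∈ S, -a ∈ S) (hK : Kᴴ = -K)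
    (hB : ∀ k s, B (Function.update s k (-s k)) = B s) :
    ∑ s ∈ blocks S N, delayTrace (B s * (∑ n, tonePowerDeriv₂ K s n • A n) * B s) =
      -∑ n, ∑ m, ∑ s ∈ blocks S N, ‖K n m‖ ^ 2 * (‖s n‖ ^ 2 - ‖s m‖ ^ 2) *
        delayTrace (B s * (A n - A m) * B s) := by
  let w : Fin N → (Fin N → ℂ) → ℝ := fun n s => delayTrace (B s * A n * B s)
  have hw : ∀ n k s, w n (Function.update s k (-s k)) = w n s := fun n k s => by
    simp only [w, hB]
  have h1 : ∀ s, delayTrace (B s * (∑ n, tonePowerDeriv₂ K s n • A n) * B s) =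
      ∑ n, tonePowerDeriv₂ K s n * w n s := fun s => by
    rw [Matrix.mul_sum, Matrix.sum_mul, delayTrace_sum]
    refine sum_congr rfl fun n _ => ?_
    rw [Matrix.mul_smul, Matrix.smul_mul, delayTrace_smul]
  have h2 : ∀ n, ∑ s ∈ blocks S N, tonePowerDeriv₂ K s n * w n s =
      ∑ s ∈ blocks S N, ∑ m, 2 * (‖K n m‖ ^ 2 * (‖s m‖ ^ 2 - ‖s n‖ ^ 2) * w n s) := by
    intro n
    have e : ∀ s, tonePowerDeriv₂ K s n * w n s = 2 * (‖(K *ᵥ s) n‖ ^ 2 * w n s) +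
        2 * ((star (s n) * ((K * K) *ᵥ s) n).re * w n s) := fun s => by
      rw [tonePowerDeriv₂, Matrix.mulVec_mulVec]; ring
    simp only [e]
    rw [sum_add_distrib, ← mul_sum, ← mul_sum, sum_blocks_norm_sq hneg K n (hw n),
      sum_blocks_row hneg (K * K) n (hw n), skew_mul_self_apply hK, ← mul_add, ← sum_add_distrib,
      mul_sum]
    refine sum_congr rfl fun s _ => ?_
    rw [← mul_sum, ← sum_mul]
    simp only [mul_sub, sum_sub_distrib]
    rw [← sum_mul]
    ring
  have h3 : ∀ s, ∑ n, ∑ m, 2 * (‖K n m‖ ^ 2 * (‖s m‖ ^ 2 - ‖s n‖ ^ 2) * w n s) =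
      -∑ n, ∑ m, ‖K n m‖ ^ 2 * (‖s n‖ ^ 2 - ‖s m‖ ^ 2) * delayTrace (B s * (A n - A m) * B s) := by
    intro s
    have e1 : ∀ n m, delayTrace (B s * (A n - A m) * B s) = w n s - w m s := fun n m => by
      rw [Matrix.mul_sub, Matrix.sub_mul, delayTrace_sub]
    have e2 : ∑ n, ∑ m, ‖K n m‖ ^ 2 * (‖s m‖ ^ 2 - ‖s n‖ ^ 2) * w n s =
        ∑ n, ∑ m, ‖K n m‖ ^ 2 * (‖s n‖ ^ 2 - ‖s m‖ ^ 2) * w m s := by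
      rw [sum_comm]
      refine sum_congr rfl fun n _ => sum_congr rfl fun m _ => ?_
      rw [norm_skew_symm hK]
    have e3 : ∑ n, ∑ m, 2 * (‖K n m‖ ^ 2 * (‖s m‖ ^ 2 - ‖s n‖ ^ 2) * w n s) =
        ∑ n, ∑ m, ‖K n m‖ ^ 2 * (‖s m‖ ^ 2 - ‖s n‖ ^ 2) * w n s +
        ∑ n, ∑ m, ‖K n m‖ ^ 2 * (‖s n‖ ^ 2 - ‖s m‖ ^ 2) * w m s := by
      rw [← e2]
      simp only [← mul_sum]
      ring
    rw [e3, ← sum_add_distrib, ← sum_neg_distrib]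
    refine sum_congr rfl fun n _ => ?_
    rw [← sum_add_distrib, ← sum_neg_distrib]
    refine sum_congr rfl fun m _ => ?_
    rw [e1]
    ring
  simp only [h1]
  rw [sum_comm, sum_congr rfl fun n _ => h2 n, sum_comm, sum_congr rfl fun s _ => h3 s,
    sum_neg_distrib, sum_comm]
  congr 1
  exact sum_congr rfl fun n _ => sum_comm

end Hessian

end Blocks

/-! ### Moments of the constellation -/

section Constellation

variable {S : Finset ℂ}

lemma IsSubGaussianConstellation.card_pos (hS : IsSubGaussianConstellation S) :
    (0 : ℝ) < S.card := by
  have h := hS.unit_power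
  rcases Nat.eq_zero_or_pos S.card with h0 | h0
  · rw [symbolMeanReal, h0] at h
    simp at h
  · exact_mod_cast h0

lemma IsSubGaussianConstellation.neg_mem (hS : IsSubGaussianConstellation S) :
    ∀ a ∈ S, -a ∈ S := fun a ha => hS.central_symmetry _ a ha rfl

lemma IsSubGaussianConstellation.sum_norm_sq (hS : IsSubGaussianConstellation S) :
    ∑ a ∈ S, ‖a‖ ^ 2 = S.card := by
  have h := hS.unit_power
  rw [symbolMeanReal, div_eq_one_iff_eq hS.card_pos.ne'] at h
  exact h

lemma IsSubGaussianConstellation.sum_sq (hS : IsSubGaussianConstellation S) :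
    ∑ a ∈ S, a ^ 2 = 0 := by
  have h := hS.pseudo_variance_zero
  rw [symbolMean, div_eq_zero_iff] at h
  exact h.resolve_right (by exact_mod_cast hS.card_pos.ne')

lemma IsSubGaussianConstellation.kurtosis_eq (hS : IsSubGaussianConstellation S) :
    kurtosis S = (∑ a ∈ S, ‖a‖ ^ 4) / S.card := by
  have h1 := hS.unit_power
  have h2 := hS.mean_zero
  rw [kurtosis, h2]
  simp only [sub_zero]
  rw [h1, one_pow, div_one, symbolMeanReal]

/-- In `(2 Re w)² = 2|w|² + 2 Re w²` the second term averages to zero by the vanishing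
pseudo-variance; the first is fixed by unit power. -/
lemma IsSubGaussianConstellation.sum_exchange_sq (hS : IsSubGaussianConstellation S) (z : ℂ) :
    ∑ a ∈ S, ∑ b ∈ S, (2 * (star a * (z * b)).re) ^ 2 = 2 * ‖z‖ ^ 2 * (S.card : ℝ) ^ 2 := by
  have h1 : ∀ w : ℂ, (2 * w.re) ^ 2 = 2 * ‖w‖ ^ 2 + 2 * (w ^ 2).re := fun w => by
    rw [← Complex.normSq_eq_norm_sq, Complex.normSq_apply, sq w, Complex.mul_re]
    ring
  have h2 : ∑ a ∈ S, ∑ b ∈ S, ‖star a * (z * b)‖ ^ 2 = ‖z‖ ^ 2 * (S.card : ℝ) ^ 2 := by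
    have : ∀ a b : ℂ, ‖star a * (z * b)‖ ^ 2 = ‖z‖ ^ 2 * (‖a‖ ^ 2 * ‖b‖ ^ 2) := fun a b => by
      rw [norm_mul, norm_mul, norm_star]; ring
    simp only [this, ← mul_sum]
    rw [hS.sum_norm_sq, ← sum_mul, hS.sum_norm_sq]
    ring
  have h3 : ∑ a ∈ S, ∑ b ∈ S, ((star a * (z * b)) ^ 2).re = 0 := by
    have : ∀ a : ℂ, ∑ b ∈ S, ((star a * (z * b)) ^ 2).re = 0 := fun a => by
      rw [← Complex.re_sum]
      have e : ∀ b : ℂ, (star a * (z * b)) ^ 2 = (star a * z) ^ 2 * b ^ 2 := fun b => by ring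
      simp only [e, ← mul_sum, hS.sum_sq, mul_zero, Complex.zero_re]
    simp only [this, sum_const_zero]
  simp only [h1, sum_add_distrib, ← mul_sum]
  rw [h2, h3]
  ring

lemma IsSubGaussianConstellation.sum_power_difference_sq (hS : IsSubGaussianConstellation S) :
    ∑ a ∈ S, ∑ b ∈ S, (‖a‖ ^ 2 - ‖b‖ ^ 2) ^ 2 = 2 * (S.card : ℝ) ^ 2 * (kurtosis S - 1) := by
  have h0 := hS.card_pos.ne'
  have h1 : ∀ a b : ℂ, (‖a‖ ^ 2 - ‖b‖ ^ 2) ^ 2 = ‖a‖ ^ 4 - 2 * (‖a‖ ^ 2 * ‖b‖ ^ 2) + ‖b‖ ^ 4 :=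
    fun a b => by ring
  have h2 : ∑ a ∈ S, ‖a‖ ^ 4 = S.card * kurtosis S := by
    rw [hS.kurtosis_eq]; field_simp
  simp only [h1, sum_add_distrib, sum_sub_distrib, ← mul_sum, sum_const, nsmul_eq_mul, h2,
    hS.sum_norm_sq]
  rw [← sum_mul, hS.sum_norm_sq]
  ring

/-- The interval also contains `1`, so that the uniform bounds cover the reference allocation in
which two powers are reset to `1`. -/
lemma IsSubGaussianConstellation.exists_power_bounds (hS : IsSubGaussianConstellation S) :
    ∃ ρ₁ ρ₂ : ℝ, 0 < ρ₁ ∧ (1 : ℝ) ∈ Set.Icc ρ₁ ρ₂ ∧ ∀ a ∈ S, ‖a‖ ^ 2 ∈ Set.Icc ρ₁ ρ₂ := by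
  have hne : S.Nonempty := Finset.card_pos.1 (by exact_mod_cast hS.card_pos)
  obtain ⟨a, ha, hmin⟩ := S.exists_min_image (fun a => ‖a‖ ^ 2) hne
  obtain ⟨b, hb, hmax⟩ := S.exists_max_image (fun a => ‖a‖ ^ 2) hne
  have ha0 : a ≠ 0 := fun h => hS.zero_notMem (h ▸ ha)
  have hpos : 0 < ‖a‖ ^ 2 := by positivity
  exact ⟨min 1 (‖a‖ ^ 2), max 1 (‖b‖ ^ 2), lt_min one_pos hpos,
    ⟨min_le_left _ _, le_max_left _ _⟩,
    fun c hc => ⟨(min_le_right _ _).trans (hmin c hc), (hmax c hc).trans (le_max_right _ _)⟩⟩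

end Constellation

/-! ### The contribution of a pair of tones -/

lemma exists_pair_nonneg {S : Finset ℂ} (hS : IsSubGaussianConstellation S)
    (τ : Fin L → ℝ) (hτ : Function.Injective τ) (β : Fin L → ℂ) (hβ : ∀ l, β l ≠ 0) :
    ∃ N₀ : ℕ, ∀ N ≥ N₀,
      (∀ s ∈ blocks S N, IsUnit (powerInfo τ β fun n => ‖s n‖ ^ 2).det) ∧
      ∀ (K : Matrix (Fin N) (Fin N) ℂ) (n m : Fin N), n ≠ m →
      0 ≤ ∑ s ∈ blocks S N, (exchange K s n m ^ 2 *
          delayTrace ((powerInfo τ β fun n => ‖s n‖ ^ 2)⁻¹ *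
            (toneInfo τ β ((n : ℕ) / N : ℝ) - toneInfo τ β ((m : ℕ) / N : ℝ)) *
            (powerInfo τ β fun n => ‖s n‖ ^ 2)⁻¹ *
            (toneInfo τ β ((n : ℕ) / N : ℝ) - toneInfo τ β ((m : ℕ) / N : ℝ)) *
            (powerInfo τ β fun n => ‖s n‖ ^ 2)⁻¹) +
          ‖K n m‖ ^ 2 * (‖s n‖ ^ 2 - ‖s m‖ ^ 2) *
          delayTrace ((powerInfo τ β fun n => ‖s n‖ ^ 2)⁻¹ *
            (toneInfo τ β ((n : ℕ) / N : ℝ) - toneInfo τ β ((m : ℕ) / N : ℝ)) *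
            (powerInfo τ β fun n => ‖s n‖ ^ 2)⁻¹)) := by
  obtain ⟨ρ₁, ρ₂, hρ₁, hone, hρ⟩ := hS.exists_power_bounds
  obtain ⟨c, hc, _, -, N₁, hN₁, hJ⟩ := exists_powerInfo_bounds τ hτ β hβ (ρ₂ := ρ₂) hρ₁
  obtain ⟨C, hC, N₂, hN₂, hpert⟩ := exists_curvatureForm_perturbation τ hτ β hβ (ρ₂ := ρ₂) hρ₁
  have hκ : 0 < 2 - kurtosis S := sub_pos.2 hS.kurtosis_lt_two
  -- The last summand makes the relative error `ε = C / N` satisfy `2 ε ≤ 2 - κ`; this is where the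
  -- strict inequality `κ < 2` enters.
  refine ⟨N₁ + N₂ + ⌈2 * C / (2 - kurtosis S)⌉₊, fun N hN => ?_⟩
  have hN₁' : N ≥ N₁ := by omega
  have hN₂' : N ≥ N₂ := by omega
  have hN' : (0 : ℝ) < N := by exact_mod_cast (by omega : 0 < N)
  have hunit : ∀ p : Fin N → ℝ, (∀ k, p k ∈ Set.Icc ρ₁ ρ₂) → IsUnit (powerInfo τ β p).det :=
    fun p hp => isUnit_det_of_coercive (by positivity : 0 < c * N) fun w => (hJ N hN₁' p hp w).1
  have hpow : ∀ s ∈ blocks S N, ∀ k, ‖s k‖ ^ 2 ∈ Set.Icc ρ₁ ρ₂ := fun s hs k =>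
    hρ _ (mem_blocks.1 hs k)
  refine ⟨fun s hs => hunit _ (hpow s hs), fun K n m hnm => ?_⟩
  set Δ := toneInfo τ β ((n : ℕ) / N : ℝ) - toneInfo τ β ((m : ℕ) / N : ℝ) with hΔ
  have hΔt : Δᵀ = Δ := by rw [hΔ, Matrix.transpose_sub, toneInfo_transpose, toneInfo_transpose]
  let B : (Fin N → ℂ) → Matrix (Param L) (Param L) ℝ := fun s =>
    (powerInfo τ β fun n => ‖s n‖ ^ 2)⁻¹
  have hBt : ∀ s, (B s)ᵀ = B s := fun s => inv_transpose_of_symm (powerInfo_transpose _ _ _)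
  -- Resetting the powers of `n` and `m` to `1` makes the curvature `G` independent of these two
  -- symbols.
  let ref : (Fin N → ℂ) → Fin N → ℝ := fun s =>
    Function.update (Function.update (fun n => ‖s n‖ ^ 2) n 1) m 1
  let G : (Fin N → ℂ) → ℝ := fun s =>
    curvatureForm (powerInfo τ β (ref s))⁻¹ (Δ * (powerInfo τ β (ref s))⁻¹)
  let e : Equiv.Perm (Fin N) := Equiv.swap n m
  have href : ∀ s, ∀ k, k ≠ n → k ≠ m → ref s k = ‖s k‖ ^ 2 := fun s k h1 h2 => by
    simp only [ref]
    rw [Function.update_of_ne h2, Function.update_of_ne h1]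
  have hrefI : ∀ s ∈ blocks S N, ∀ k, ref s k ∈ Set.Icc ρ₁ ρ₂ := by
    intro s hs k
    by_cases h2 : k = m
    · subst h2; simp only [ref, Function.update_self]; exact hone
    by_cases h1 : k = n
    · subst h1; simp only [ref]; rw [Function.update_of_ne h2, Function.update_self]; exact hone
    · rw [href s k h1 h2]; exact hpow s hs k
  have hGn : ∀ s a, G (Function.update s n a) = G s := by
    intro s a
    have : ref (Function.update s n a) = ref s := by
      funext k
      by_cases h2 : k = m
      · subst h2; simp only [ref, Function.update_self]
      by_cases h1 : k = n
      · subst h1; simp only [ref]; rw [Function.update_of_ne h2, Function.update_of_ne h2,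
          Function.update_self, Function.update_self]
      · rw [href _ k h1 h2, href _ k h1 h2, Function.update_of_ne h1]
    simp only [G, this]
  have hGm : ∀ s a, G (Function.update s m a) = G s := by
    intro s a
    have : ref (Function.update s m a) = ref s := by
      funext k
      by_cases h2 : k = m
      · subst h2; simp only [ref, Function.update_self]
      by_cases h1 : k = n
      · subst h1; simp only [ref]; rw [Function.update_of_ne h2, Function.update_of_ne h2,
          Function.update_self, Function.update_self]
      · rw [href _ k h1 h2, href _ k h1 h2, Function.update_of_ne h2]
    simp only [G, this]
  set ε := C / N with hε
  have hε0 : 0 ≤ ε := by positivity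
  have hεκ : 2 * ε ≤ 2 - kurtosis S := by
    have h1 : 2 * C / (2 - kurtosis S) ≤ N := by
      refine (Nat.le_ceil _).trans ?_
      exact_mod_cast (by omega : ⌈2 * C / (2 - kurtosis S)⌉₊ ≤ N)
    rw [div_le_iff₀ hκ] at h1
    rw [hε, mul_div_assoc', div_le_iff₀ hN']
    linarith
  have hcomp : ∀ s ∈ blocks S N, s ∘ e ∈ blocks S N := fun s hs =>
    mem_blocks.2 fun k => mem_blocks.1 hs (e k)
  have hoff : ∀ s : Fin N → ℂ, ∀ k, k ≠ n → k ≠ m → ‖(s ∘ e) k‖ ^ 2 = ref s k := fun s k h1 h2 => by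
    rw [href s k h1 h2, Function.comp_apply, Equiv.swap_apply_of_ne_of_ne h1 h2]
  have hoff' : ∀ s : Fin N → ℂ, ∀ k, k ≠ n → k ≠ m → ‖s k‖ ^ 2 = ref s k := fun s k h1 h2 =>
    (href s k h1 h2).symm
  have hG0 : ∀ s ∈ blocks S N, 0 ≤ G s := fun s hs =>
    (hpert N hN₂' n m hnm _ _ (ref s) (hpow s hs) (hpow s hs) (hrefI s hs) (hoff' s) (hoff' s)).1
  have hlow : ∀ s ∈ blocks S N, (1 - ε) * G s ≤ curvatureForm (B s) (Δ * B s) := fun s hs => by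
    have := (hpert N hN₂' n m hnm _ _ (ref s) (hpow s hs) (hpow s hs) (hrefI s hs) (hoff' s)
      (hoff' s)).2
    have := (abs_le.1 this).1
    simp only [G, B]
    linarith
  have hup₁ : ∀ s ∈ blocks S N, curvatureForm (B (s ∘ e)) (Δ * B s) ≤ (1 + ε) * G s := fun s hs => by
    have := (hpert N hN₂' n m hnm _ _ (ref s) (hpow s hs) (hpow _ (hcomp s hs)) (hrefI s hs)
      (hoff' s) (hoff s)).2
    have := (abs_le.1 this).2
    simp only [G, B]
    linarith
  have hup₂ : ∀ s ∈ blocks S N, curvatureForm (B s) (Δ * B (s ∘ e)) ≤ (1 + ε) * G s := fun s hs => by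
    have := (hpert N hN₂' n m hnm _ _ (ref s) (hpow _ (hcomp s hs)) (hpow s hs) (hrefI s hs)
      (hoff s) (hoff' s)).2
    have := (abs_le.1 this).2
    simp only [G, B]
    linarith
  have hcurv : ∀ s t, delayTrace (B s * Δ * B t * Δ * B s) = curvatureForm (B t) (Δ * B s) :=
    fun s t => by
      rw [curvatureForm, Matrix.transpose_mul, hBt, hΔt]
      simp only [mul_assoc]
  -- the exchange of the two symbols
  have hdiff : ∀ s ∈ blocks S N, B s - B (s ∘ e) =
      -((‖s n‖ ^ 2 - ‖s m‖ ^ 2) • (B s * Δ * B (s ∘ e))) := by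
    intro s hs
    have h1 := inv_sub_inv_eq (hunit _ (hpow s hs)) (hunit _ (hpow _ (hcomp s hs)))
    have h2 : (powerInfo τ β fun n => ‖s n‖ ^ 2) - (powerInfo τ β fun n => ‖(s ∘ e) n‖ ^ 2) =
        (‖s n‖ ^ 2 - ‖s m‖ ^ 2) • Δ := by
      rw [powerInfo_sub, powerInfo_eq_of_eq_off_pair τ β hnm _ (fun k h1 h2 => by
        rw [Pi.sub_apply, hoff s k h1 h2, hoff' s k h1 h2, sub_self])]
      simp only [Pi.sub_apply, Function.comp_apply, e, Equiv.swap_apply_left,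
        Equiv.swap_apply_right]
      rw [hΔ, smul_sub, sub_eq_add_neg (_ • toneInfo τ β ((n : ℕ) / N : ℝ)), ← neg_smul, neg_sub]
    rw [h2] at h1
    simp only [B]
    rw [h1, Matrix.mul_smul, Matrix.smul_mul]
  -- The two curvature terms mix the inverses before and after the exchange. The perturbation
  -- estimate admits two different allocations for this reason.
  have hdiff' : ∀ s ∈ blocks S N, delayTrace (B s * Δ * B s) - delayTrace (B (s ∘ e) * Δ * B (s ∘ e))
      = -((‖s n‖ ^ 2 - ‖s m‖ ^ 2) *
        (curvatureForm (B (s ∘ e)) (Δ * B s) + curvatureForm (B s) (Δ * B (s ∘ e)))) := by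
    intro s hs
    have h1 : B s * Δ * B s - B (s ∘ e) * Δ * B (s ∘ e) =
        (B s - B (s ∘ e)) * Δ * B s + B (s ∘ e) * Δ * (B s - B (s ∘ e)) := by noncomm_ring
    rw [← delayTrace_sub, h1, hdiff s hs, Matrix.neg_mul, Matrix.neg_mul, Matrix.mul_neg,
      ← neg_add, delayTrace_neg, Matrix.smul_mul, Matrix.smul_mul, Matrix.mul_smul, ← smul_add,
      delayTrace_smul, ← hcurv, ← hcurv]
    congr 2
    simp only [delayTrace, Matrix.add_apply, sum_add_distrib, mul_assoc]
  -- The power difference is odd under the exchange of the two symbols, so only the odd part of the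
  -- trace contributes; by `hdiff'` that part has the power difference as a further factor.
  have hswap : ∑ s ∈ blocks S N, (‖s n‖ ^ 2 - ‖s m‖ ^ 2) * delayTrace (B s * Δ * B s) =
      ∑ s ∈ blocks S N, -(1 / 2) * ((‖s n‖ ^ 2 - ‖s m‖ ^ 2) ^ 2 *
        (curvatureForm (B (s ∘ e)) (Δ * B s) + curvatureForm (B s) (Δ * B (s ∘ e)))) := by
    have h1 := sum_blocks_comp_perm (S := S) e
      (fun s => (‖s n‖ ^ 2 - ‖s m‖ ^ 2) * delayTrace (B s * Δ * B s))
    simp only [Function.comp_apply, e, Equiv.swap_apply_left, Equiv.swap_apply_right] at h1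
    have h2 : ∑ s ∈ blocks S N, (‖s n‖ ^ 2 - ‖s m‖ ^ 2) * delayTrace (B s * Δ * B s) =
        ∑ s ∈ blocks S N, (1 / 2) * ((‖s n‖ ^ 2 - ‖s m‖ ^ 2) *
          (delayTrace (B s * Δ * B s) - delayTrace (B (s ∘ e) * Δ * B (s ∘ e)))) := by
      rw [← mul_sum]
      simp only [mul_sub, sum_sub_distrib]
      have h3 : ∑ s ∈ blocks S N, (‖s n‖ ^ 2 - ‖s m‖ ^ 2) * delayTrace (B (s ∘ e) * Δ * B (s ∘ e)) =
          -∑ s ∈ blocks S N, (‖s n‖ ^ 2 - ‖s m‖ ^ 2) * delayTrace (B s * Δ * B s) := by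
        rw [← h1, ← sum_neg_distrib]
        exact sum_congr rfl fun s _ => by ring
      rw [h3]
      ring
    rw [h2]
    refine sum_congr rfl fun s hs => ?_
    rw [hdiff' s hs]
    ring
  have hcard := hS.card_pos
  have hmain : ∑ s ∈ blocks S N, ((2 * (star (s n) * (K n m * s m)).re) ^ 2 * (1 - ε)
      - ‖K n m‖ ^ 2 * (‖s n‖ ^ 2 - ‖s m‖ ^ 2) ^ 2 * (1 + ε)) * G s ≤
      ∑ s ∈ blocks S N, (exchange K s n m ^ 2 * delayTrace (B s * Δ * B s * Δ * B s) +
        ‖K n m‖ ^ 2 * (‖s n‖ ^ 2 - ‖s m‖ ^ 2) * delayTrace (B s * Δ * B s)) := by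
    have h1 : ∑ s ∈ blocks S N, ‖K n m‖ ^ 2 * (‖s n‖ ^ 2 - ‖s m‖ ^ 2) *
        delayTrace (B s * Δ * B s) = ∑ s ∈ blocks S N, ‖K n m‖ ^ 2 * (-(1 / 2) *
        ((‖s n‖ ^ 2 - ‖s m‖ ^ 2) ^ 2 * (curvatureForm (B (s ∘ e)) (Δ * B s) +
          curvatureForm (B s) (Δ * B (s ∘ e))))) := by
      rw [← mul_sum, ← hswap, mul_sum]
      exact sum_congr rfl fun s _ => by ring
    rw [sum_add_distrib, h1, ← sum_add_distrib]
    refine sum_le_sum fun s hs => ?_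
    have h2 : exchange K s n m ^ 2 * ((1 - ε) * G s) ≤
        exchange K s n m ^ 2 * delayTrace (B s * Δ * B s * Δ * B s) := by
      rw [hcurv]
      exact mul_le_mul_of_nonneg_left (hlow s hs) (sq_nonneg _)
    have h3 : ‖K n m‖ ^ 2 * (‖s n‖ ^ 2 - ‖s m‖ ^ 2) ^ 2 * (curvatureForm (B (s ∘ e)) (Δ * B s) +
        curvatureForm (B s) (Δ * B (s ∘ e))) ≤ ‖K n m‖ ^ 2 * (‖s n‖ ^ 2 - ‖s m‖ ^ 2) ^ 2 *
        ((1 + ε) * G s + (1 + ε) * G s) :=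
      mul_le_mul_of_nonneg_left (add_le_add (hup₁ s hs) (hup₂ s hs)) (by positivity)
    rw [exchange] at h2 ⊢
    linarith
  refine le_trans ?_ hmain
  have hfub := card_sq_mul_sum_blocks (S := S) hnm (fun a b =>
    (2 * (star a * (K n m * b)).re) ^ 2 * (1 - ε) - ‖K n m‖ ^ 2 * (‖a‖ ^ 2 - ‖b‖ ^ 2) ^ 2 * (1 + ε))
    hGn hGm
  have hmom : ∑ a ∈ S, ∑ b ∈ S, ((2 * (star a * (K n m * b)).re) ^ 2 * (1 - ε)
      - ‖K n m‖ ^ 2 * (‖a‖ ^ 2 - ‖b‖ ^ 2) ^ 2 * (1 + ε)) =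
      -- This is `2 |K_nm|² (1 - ε) - 2 |K_nm|² (κ - 1) (1 + ε)`, up to the number of symbol pairs.
      2 * ‖K n m‖ ^ 2 * (S.card : ℝ) ^ 2 * (2 - kurtosis S - ε * kurtosis S) := by
    simp only [sum_sub_distrib, ← sum_mul, ← mul_sum]
    rw [hS.sum_exchange_sq, hS.sum_power_difference_sq]
    ring
  rw [hmom] at hfub
  have hfac : 0 ≤ 2 - kurtosis S - ε * kurtosis S := by
    have := mul_le_mul_of_nonneg_left hS.kurtosis_lt_two.le hε0
    linarith
  have hsumG : 0 ≤ ∑ s ∈ blocks S N, G s := sum_nonneg hG0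
  have hpos : 0 ≤ (S.card : ℝ) ^ 2 * ∑ s ∈ blocks S N,
      ((2 * (star (s n) * (K n m * s m)).re) ^ 2 * (1 - ε)
      - ‖K n m‖ ^ 2 * (‖s n‖ ^ 2 - ‖s m‖ ^ 2) ^ 2 * (1 + ε)) * G s := by
    rw [hfub]; positivity
  exact nonneg_of_mul_nonneg_right hpos (by positivity)

/-! ### The Hessian at OFDM -/

lemma crbAlong_eq (S : Finset ℂ) (N : ℕ) {σ : ℝ} (hσ : 0 < σ) (τ : Fin L → ℝ) (β : Fin L → ℂ)
    (K : Matrix (Fin N) (Fin N) ℂ) : crbAlong S N σ τ β K = fun t =>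
      σ ^ 2 / 2 / ((blocks S N).card : ℝ) *
        ∑ s ∈ blocks S N, delayTrace (powerInfo τ β (tonePower K s t))⁻¹ := by
  funext t
  rw [crbAlong, expectedCRB, blockMean]
  simp only [geodesic, conditionalCRB_eq N hσ]
  rw [← mul_sum, mul_div_right_comm]
  rfl

lemma eventually_isUnit_det_fim (S : Finset ℂ) (N : ℕ) {σ : ℝ} (hσ : 0 < σ) (τ : Fin L → ℝ)
    (β : Fin L → ℂ) (K : Matrix (Fin N) (Fin N) ℂ)
    (h : ∀ s ∈ blocks S N, IsUnit (powerInfo τ β fun n => ‖s n‖ ^ 2).det) :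
    ∀ᶠ t in 𝓝 (0 : ℝ), ∀ s ∈ blocks S N,
      IsUnit (fim N σ (geodesic K t *ᵥ s) (paramVec τ β)).det := by
  refine (Filter.eventually_all_finset _).2 fun s hs => ?_
  have hcont : Continuous fun t => (powerInfo τ β (tonePower K s t)).det := by
    refine Continuous.matrix_det ?_
    simp only [powerInfo]
    exact continuous_finsetSum _ fun n _ =>
      ((contDiff_tonePower K s 0 n).continuous).smul continuous_const
  have h0 := (h s hs).ne_zero
  rw [← tonePower_zero K s] at h0
  filter_upwards [hcont.continuousAt.eventually_ne h0] with t ht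
  rw [geodesic, ← Matrix.mulVec_mulVec, fim_eq, Matrix.det_smul, isUnit_iff_ne_zero]
  exact mul_ne_zero (by positivity) ht

lemma exists_wellDefined_and_hessianForm_nonneg {S : Finset ℂ} (hS : IsSubGaussianConstellation S)
    (τ : Fin L → ℝ) (hτ : Function.Injective τ) (β : Fin L → ℂ) (hβ : ∀ l, β l ≠ 0) {σ : ℝ}
    (hσ : 0 < σ) : ∃ N₀ : ℕ, ∀ N ≥ N₀, ∀ K : Matrix (Fin N) (Fin N) ℂ, Kᴴ = -K →
      WellDefinedNearZero S N σ τ β K ∧ 0 ≤ hessianForm S N σ τ β K := by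
  obtain ⟨N₀, h⟩ := exists_pair_nonneg hS τ hτ β hβ
  refine ⟨N₀, fun N hN K hK => ?_⟩
  obtain ⟨hunit, hpair⟩ := h N hN
  have hsmooth : ∀ s ∈ blocks S N, ContDiffAt ℝ 2
      (fun t => delayTrace (powerInfo τ β (tonePower K s t))⁻¹) 0 := fun s hs =>
    contDiffAt_delayTrace_inv τ β K s (hunit s hs)
  refine ⟨⟨eventually_isUnit_det_fim S N hσ τ β K hunit, ?_⟩, ?_⟩
  · rw [crbAlong_eq S N hσ]
    exact contDiffAt_const.mul (ContDiffAt.sum hsmooth)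
  · rw [hessianForm, crbAlong_eq S N hσ, iteratedDeriv_const_mul_field, ← iteratedDerivWithin_univ,
      iteratedDerivWithin_fun_sum (Set.mem_univ _) uniqueDiffOn_univ
        (fun s hs => (hsmooth s hs).contDiffWithinAt)]
    refine mul_nonneg (by positivity) ?_
    simp only [iteratedDerivWithin_univ]
    rw [sum_congr rfl fun s hs => iteratedDeriv_two_delayTrace_powerInfo_inv τ β K s (hunit s hs),
      sum_sub_distrib]
    -- The inverse information matrix is even in every symbol, which is what the averaging over
    -- signs requires.
    have hB : ∀ (k : Fin N) (s : Fin N → ℂ),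
        (powerInfo τ β fun n => ‖Function.update s k (-s k) n‖ ^ 2)⁻¹ =
          (powerInfo τ β fun n => ‖s n‖ ^ 2)⁻¹ := by
      intro k s
      congr 2
      funext n
      by_cases hn : n = k
      · subst hn; rw [Function.update_self, norm_neg]
      · rw [Function.update_of_ne hn]
    have h1 := sum_blocks_first_order (S := S) (fun n : Fin N => toneInfo τ β ((n : ℕ) / N : ℝ))
      (B := fun s => (powerInfo τ β fun n => ‖s n‖ ^ 2)⁻¹) hS.neg_mem hK hB
    have h2 := sum_blocks_second_order (S := S) (fun n : Fin N => toneInfo τ β ((n : ℕ) / N : ℝ))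
      (B := fun s => (powerInfo τ β fun n => ‖s n‖ ^ 2)⁻¹) hS.neg_mem hK hB
    change 0 ≤ ∑ s ∈ blocks S N, 2 * delayTrace ((powerInfo τ β fun n => ‖s n‖ ^ 2)⁻¹ *
      (∑ n : Fin N, tonePowerDeriv K s n • toneInfo τ β ((n : ℕ) / N : ℝ)) * _ *
      (∑ n : Fin N, tonePowerDeriv K s n • toneInfo τ β ((n : ℕ) / N : ℝ)) * _) -
      ∑ s ∈ blocks S N, delayTrace (_ *
      (∑ n : Fin N, tonePowerDeriv₂ K s n • toneInfo τ β ((n : ℕ) / N : ℝ)) * _)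
    rw [h1, h2, sub_neg_eq_add, ← sum_add_distrib]
    refine sum_nonneg fun n _ => ?_
    rw [← sum_add_distrib]
    refine sum_nonneg fun m _ => ?_
    rw [← sum_add_distrib]
    by_cases hnm : n = m
    · subst hnm
      simp [delayTrace]
    · exact hpair K n m hnm

end OFDM

end

theorem theorem3 (S : Finset ℂ) (hS : OFDM.IsSubGaussianConstellation S)
    (L : ℕ) (τ : Fin L → ℝ) (hτ : Function.Injective τ)
    (β : Fin L → ℂ) (hβ : ∀ l, β l ≠ 0) (σ : ℝ) (hσ : 0 < σ) :
    -- every family of skew-Hermitian unit directions has its own threshold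
    (∀ K : (N : ℕ) → Matrix (Fin N) (Fin N) ℂ,
      (∀ N, 1 ≤ N → (K N)ᴴ = -(K N) ∧ OFDM.specNorm (K N) = 1) →
      ∃ N₀ : ℕ, ∀ N ≥ N₀,
        OFDM.WellDefinedNearZero S N σ τ β (K N) ∧
        0 ≤ iteratedDeriv 2
          (fun t : ℝ => OFDM.expectedCRB S N σ τ β ((OFDM.dft N)ᴴ * NormedSpace.exp (t • K N)))
          0) ∧
    -- the Riemannian Hessian at OFDM is positive semidefinite for all large `N`
    (∃ N₀ : ℕ, ∀ N ≥ N₀, ∀ K : Matrix (Fin N) (Fin N) ℂ, Kᴴ = -K →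
      OFDM.WellDefinedNearZero S N σ τ β K ∧ 0 ≤ OFDM.hessianForm S N σ τ β K) := by
  have main := OFDM.exists_wellDefined_and_hessianForm_nonneg hS τ hτ β hβ hσ
  refine ⟨fun K hK => ?_, main⟩
  obtain ⟨N₀, h⟩ := main
  -- The maximum with `1` is needed because the family is assumed skew-Hermitian only from `N = 1`
  -- on.
  exact ⟨max N₀ 1, fun N hN => h N (le_of_max_le_left hN) (K N) (hK N (le_of_max_le_right hN)).1⟩
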